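/- **Setting.** There are $N\ge 3$ buyers with unit demand. Their valuations $X_1,\dots,X_N$ are independent with distribution $F$ supported on $[\underline x,\bar x]$, $0\le\underline x<\bar x$, with a density $f$ continuous on $[\underline x,\bar x]$ and positive on $(\underline x,\bar x)$. The virtual valuation is $\psi(x)=x-\frac{1-F(x)}{f(x)}$. Write $X_{(k)}$ for the $k$-th highest valuation. Two sellers each sell one identical unit in sequence. The second uses a second-price auction without reserve price, in which every buyer who did not get the first unit takes part and bids his valuation. The first seller chooses a mechanism. A *direct mechanism* assigns to each vector of reported types nonnegative allocation probabilities with sum at most $1$ and a payment for each buyer (with well-defined expectations). It is *incentive compatible* if truthful reporting maximizes each type's interim expected payoff over both auctions when the others are truthful, and *individually rational* if each type's truthful payoff is at least $E\max\{x-Y_{(1)},0\}$ (what the second auction gives if the first unit is withheld), where $Y_{(1)}\geq Y_{(2)}\ge\dots$ are the ordered valuations of the $N-1$ rivals. The *optimal expected revenue* is the maximum over these mechanisms of the first seller's expected total payments under truthful reporting. Let $G_1=F^{N-1}$ and $G_2=F^{N-1}+(N-1)F^{N-2}(1-F)$ be the distributions of $Y_{(1)},Y_{(2)}$, with densities $g_1,g_2$.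 Let $a_0=\inf\{t\in(\underline x,\bar x]: t+\psi(t)\ge 0\}$ and $x_0=\psi^{-1}(0)=\inf\{t\in(\underline x,\bar x]:\psi(t)\ge0\}$. Let $H=G_1$ on $[\underline x,a_0)$, $H(q)=G_1(q)+(N-1)F(q+\psi(q))^{N-2}(1-F(q))$ on $[a_0,x_0)$, and $H=G_2$ on $[x_0,\bar x]$. Define $\beta(\underline x)=0$ and, for $x>\underline x$, $$\beta(x)=\begin{cases}\dfrac1{G_1(x)}\displaystyle\int_{\underline x}^x s\,g_1(s)\,ds, & x<a_0,\\[2ex] \dfrac1{H(x)}\Big[G_1(a_0)\beta(a_0)+\displaystyle\int_{a_0}^x s\,H'(s)\,ds\Big], & a_0\le x<x_0,\\[2ex] \dfrac1{G_2(x)}\Big[G_2(x_0)\beta(x_0)+\displaystyle\int_{x_0}^x s\,g_2(s)\,ds\Big], & x\ge x_0,\end{cases}$$ where $\beta(a_0)$ and $\beta(x_0)$ on the right-hand side are given by the formula of the preceding piece, and $$H'(s)=g_1(s)+(N-1)\Big[(N-2)F(s+\psi(s))^{N-3}(1-F(s))(1+\psi'(s))f(s+\psi(s))-F(s+\psi(s))^{N-2}f(s)\Big].$$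 *Modified pay-your-bid auction.* Each buyer submits a bid. From bid $b$ the seller infers the type $\sup\{x\in[\underline x,\bar x]:\beta(x)\le b\}$ (or $\underline x$ if there is no such $x$). With $q_{(2)},q_{(3)}$ the types inferred from the second- and third-highest bids, the second-highest bidder gets the first unit if $\psi(q_{(2)})+q_{(2)}-q_{(3)}\ge0$; otherwise nobody does. The highest bidder always pays his bid, and the second-highest bidder pays his bid if the unit is allocated. If the highest bidder wins the second auction, the first seller gives him a rebate equal to the sale price there. Ties are broken by an arbitrary fixed priority order. **Theorem.** Suppose that $\psi$ is nondecreasing on $(\underline x,\bar x)$ and differentiable on $(a_0,x_0)$. Then: 1. $\beta$ is strictly increasing on $[\underline x,\bar x]$. 2. All buyers bidding according to $\beta$ is a symmetric Bayesian equilibrium of the modified pay-your-bid auction: for each buyer and each type $x\in[\underline x,\bar x]$, when the others bid according to $\beta$, no bid $b\in\mathbb R$ gives a higher expected payoff than $\beta(x)$, and bidding $\beta(x)$ gives at least $E\max\{x-Y_{(1)},0\}$. 3. The first seller's expected revenue (net of rebates) in this equilibrium is the optimal expected revenue, and it equals $E\max\{\psi(X_{(2)})+X_{(2)}-X_{(3)},\,0\}$.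 -/

import Mathlib

open MeasureTheory

noncomputable section

/-- A distribution of buyer valuations with support `[lo, hi]`, `0 ≤ lo < hi`, having a density `f`
that is continuous on the support, positive in its interior and zero outside of it. -/
structure ValueDistribution where
  lo : ℝ
  hi : ℝ
  f : ℝ → ℝ
  lo_nonneg : 0 ≤ lo
  lo_lt_hi : lo < hi
  continuousOn_f : ContinuousOn f (Set.Icc lo hi)
  f_nonneg : ∀ x, 0 ≤ f x
  f_pos : ∀ x ∈ Set.Ioo lo hi, 0 < f x
  f_eq_zero : ∀ x, x ∉ Set.Icc lo hi → f x = 0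
  integral_f : ∫ x in lo..hi, f x = 1

/-- The `k`-th highest value (`k = 1` being the highest) among the numbers `v i`, `i ∈ s`:
the largest `t` such that at least `k` of them are `≥ t`. (For `1 ≤ k ≤ s.card`.) -/
def kthHighest {ι : Type*} (s : Finset ι) (v : ι → ℝ) (k : ℕ) : ℝ :=
  sSup {t : ℝ | k ≤ (s.filter (fun i => t ≤ v i)).card}

/-- Agent `i` has the `k`-th highest of the numbers `v j`, `j ∈ s`, where ties are broken by the
priority order `σ` (a smaller `σ` has priority). -/
def IsKthHighest {N : ℕ} (σ : Equiv.Perm (Fin N)) (s : Finset (Fin N)) (v : Fin N → ℝ) (k : ℕ)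
    (i : Fin N) : Prop :=
  i ∈ s ∧ (s.filter (fun j => v i < v j ∨ (v i = v j ∧ σ j < σ i))).card + 1 = k

/-- Surplus of buyer `i ∈ s` in a second-price auction without reserve price among the buyers in `s`
who all bid their values: `max {x_i - (highest value of the others), 0}`. -/
def secondAuctionSurplus {N : ℕ} (s : Finset (Fin N)) (x : Fin N → ℝ) (i : Fin N) : ℝ :=
  max (x i - kthHighest (s.erase i) x 1) 0

namespace ValueDistribution

variable (D : ValueDistribution)

/-- The law of one valuation. -/
def law : Measure ℝ := volume.withDensity (fun x => ENNReal.ofReal (D.f x))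

/-- The law of the vector of `N` independent valuations. -/
def jointLaw (N : ℕ) : Measure (Fin N → ℝ) := Measure.pi (fun _ => D.law)

/-- The distribution function. -/
def F (x : ℝ) : ℝ := D.law.real (Set.Iic x)

/-- The virtual valuation `ψ`. -/
def psi (x : ℝ) : ℝ := x - (1 - D.F x) / D.f x

/-- `a(x) = min {a ≥ x : a + ψ(a) ≥ x}` over types `a`. The lowest type is left out of the set, which
does not affect the infimum but allows for a density vanishing there (where `ψ` is `-∞`). -/
def a (x : ℝ) : ℝ := sInf {t : ℝ | t ∈ Set.Ioc D.lo D.hi ∧ x ≤ t ∧ x ≤ t + D.psi t}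

/-- `ψ⁻¹(0)`, the threshold type at which the virtual valuation becomes nonnegative. (It is the lowest
type if `ψ` is nonnegative throughout.) -/
def psiInvZero : ℝ := sInf {t : ℝ | t ∈ Set.Ioc D.lo D.hi ∧ 0 ≤ D.psi t}

/-- Distribution of the highest of `N - 1` competing valuations. -/
def G₁ (N : ℕ) (x : ℝ) : ℝ := D.F x ^ (N - 1)

/-- Density of the highest of `N - 1` competing valuations. -/
def g₁ (N : ℕ) (x : ℝ) : ℝ := ((N : ℝ) - 1) * D.F x ^ (N - 2) * D.f x

/-- Distribution of the second-highest of `N - 1` competing valuations. -/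
def G₂ (N : ℕ) (x : ℝ) : ℝ :=
  D.F x ^ (N - 1) + ((N : ℝ) - 1) * D.F x ^ (N - 2) * (1 - D.F x)

/-- Density of the second-highest of `N - 1` competing valuations. -/
def g₂ (N : ℕ) (x : ℝ) : ℝ :=
  ((N : ℝ) - 1) * ((N : ℝ) - 2) * D.F x ^ (N - 3) * (1 - D.F x) * D.f x

/-- The probability that a buyer bidding as type `q` pays his bid. -/
def H (N : ℕ) (q : ℝ) : ℝ :=
  if D.psiInvZero ≤ q then D.G₂ N q
  else if D.a 0 ≤ q then
    D.G₁ N q + ((N : ℝ) - 1) * D.F (q + D.psi q) ^ (N - 2) * (1 - D.F q)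
  else D.G₁ N q

/-- The derivative `H'` on the middle interval `[a(0), ψ⁻¹(0))`. -/
def H' (N : ℕ) (s : ℝ) : ℝ :=
  D.g₁ N s + ((N : ℝ) - 1) *
    (((N : ℝ) - 2) * D.F (s + D.psi s) ^ (N - 3) * (1 - D.F s) * (1 + deriv D.psi s)
        * D.f (s + D.psi s)
      - D.F (s + D.psi s) ^ (N - 2) * D.f s)

/-- The bid function on `[lo, a(0))`. -/
def bidLow (N : ℕ) (x : ℝ) : ℝ := 1 / D.G₁ N x * ∫ s in D.lo..x, s * D.g₁ N s

/-- The bid function on `[a(0), ψ⁻¹(0))`. -/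
def bidMid (N : ℕ) (x : ℝ) : ℝ :=
  1 / D.H N x * (D.G₁ N (D.a 0) * D.bidLow N (D.a 0) + ∫ s in (D.a 0)..x, s * D.H' N s)

/-- The bid function on `[ψ⁻¹(0), hi]`. -/
def bidHigh (N : ℕ) (x : ℝ) : ℝ :=
  1 / D.G₂ N x * (D.G₂ N D.psiInvZero * D.bidMid N D.psiInvZero
    + ∫ s in D.psiInvZero..x, s * D.g₂ N s)

/-- The bid function `β`. At the lowest type, where nothing is ever paid, all formulas read `0/0`,
which is `0` here, the boundary condition `β(lo) = 0`. -/
def bid (N : ℕ) (x : ℝ) : ℝ :=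
  if D.psiInvZero ≤ x then D.bidHigh N x else if D.a 0 ≤ x then D.bidMid N x else D.bidLow N x

/-- The type that the seller infers from the bid `b` if buyers bid according to `β`: the highest type
bidding at most `b`, and the lowest type for bids below all `β(x)`. For a strictly increasing `β` this
is the inverse function of `β` on its range, extended to all bids. -/
def inferredType (β : ℝ → ℝ) (b : ℝ) : ℝ :=
  max D.lo (sSup {x : ℝ | x ∈ Set.Icc D.lo D.hi ∧ β x ≤ b})

/-! ### The modified pay-your-bid auction

The rule refers to the bid function `β` that the seller uses to infer types. `b` is the vector of
bids, `x` the vector of true valuations, `σ` the tie-breaking order. -/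

/-- The good is allocated (to the second-highest bidder): `ψ(q₍₂₎) + q₍₂₎ - q₍₃₎ ≥ 0` for the types
`q₍₂₎`, `q₍₃₎` inferred from the second- and third-highest bids. -/
def Allocated {N : ℕ} (β : ℝ → ℝ) (b : Fin N → ℝ) : Prop :=
  0 ≤ D.psi (D.inferredType β (kthHighest Finset.univ b 2))
    + D.inferredType β (kthHighest Finset.univ b 2) - D.inferredType β (kthHighest Finset.univ b 3)

/-- Buyer `i` gets the first good. -/
def GetsFirst {N : ℕ} (σ : Equiv.Perm (Fin N)) (β : ℝ → ℝ) (b : Fin N → ℝ) (i : Fin N) : Prop :=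
  D.Allocated β b ∧ IsKthHighest σ Finset.univ b 2 i

open scoped Classical in
/-- The buyers who take part in the second auction: all who did not get the first good. -/
def remaining {N : ℕ} (σ : Equiv.Perm (Fin N)) (β : ℝ → ℝ) (b : Fin N → ℝ) : Finset (Fin N) :=
  Finset.univ.filter (fun i => ¬ D.GetsFirst σ β b i)

/-- The sale price in the second auction: the second-highest value of its participants. -/
def secondPrice {N : ℕ} (σ : Equiv.Perm (Fin N)) (β : ℝ → ℝ) (b x : Fin N → ℝ) : ℝ :=
  kthHighest (D.remaining σ β b) x 2

open scoped Classical in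
/-- Net payment of buyer `i` to the first seller. The highest bidder pays his bid, and so does the
second-highest bidder if the good is allocated. The highest bidder gets a rebate equal to the sale
price in the second auction if he wins the second auction. -/
def netPayment {N : ℕ} (σ : Equiv.Perm (Fin N)) (β : ℝ → ℝ) (b x : Fin N → ℝ) (i : Fin N) : ℝ :=
  (if IsKthHighest σ Finset.univ b 1 i ∨ D.GetsFirst σ β b i then b i else 0)
    - (if IsKthHighest σ Finset.univ b 1 i ∧ IsKthHighest σ (D.remaining σ β b) x 1 i
        then D.secondPrice σ β b x else 0)

open scoped Classical in
/-- Payoff of buyer `i` over both periods. -/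
def auctionPayoff {N : ℕ} (σ : Equiv.Perm (Fin N)) (β : ℝ → ℝ) (b x : Fin N → ℝ) (i : Fin N) : ℝ :=
  (if D.GetsFirst σ β b i then x i else secondAuctionSurplus (D.remaining σ β b) x i)
    - D.netPayment σ β b x i

/-- Payoff of buyer `i` with valuation `x` who bids `b`, when the other buyers have the valuations
`y j`, `j ≠ i`, and bid according to `β`. -/
def deviationPayoff {N : ℕ} (σ : Equiv.Perm (Fin N)) (β : ℝ → ℝ) (i : Fin N) (x b : ℝ)
    (y : Fin N → ℝ) : ℝ :=
  D.auctionPayoff σ β (Function.update (fun j => β (y j)) i b) (Function.update y i x) i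

/-- Expected payoff of buyer `i` with valuation `x` who skips the first auction, when the first good
is withheld. -/
def outsideOption {N : ℕ} (i : Fin N) (x : ℝ) : ℝ :=
  ∫ y, secondAuctionSurplus Finset.univ (Function.update y i x) i ∂(D.jointLaw N)

/-- All buyers bidding according to `β` is a symmetric Bayesian equilibrium: for every buyer of every
type expected payoffs are well defined, no other bid does better, and participating is at least as
good as the outside option. -/
def IsSymmetricEquilibrium {N : ℕ} (σ : Equiv.Perm (Fin N)) (β : ℝ → ℝ) : Prop :=
  ∀ (i : Fin N), ∀ x ∈ Set.Icc D.lo D.hi,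
    (∀ b : ℝ, Integrable (D.deviationPayoff σ β i x b) (D.jointLaw N)) ∧
    (∀ b : ℝ, ∫ y, D.deviationPayoff σ β i x b y ∂(D.jointLaw N)
      ≤ ∫ y, D.deviationPayoff σ β i x (β x) y ∂(D.jointLaw N)) ∧
    D.outsideOption i x ≤ ∫ y, D.deviationPayoff σ β i x (β x) y ∂(D.jointLaw N)

/-- The first seller's revenue when valuations are `x` and everybody bids according to `β`. -/
def auctionRevenue {N : ℕ} (σ : Equiv.Perm (Fin N)) (β : ℝ → ℝ) (x : Fin N → ℝ) : ℝ :=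
  ∑ i, D.netPayment σ β (fun j => β (x j)) x i

/-- A direct mechanism for the first seller: for each vector of reported types, the probabilities
`P x i` that buyer `i` gets the good, and the payments `t x i`, which have well defined expectations
both ex ante and conditional on a report. -/
structure DirectMechanism (N : ℕ) where
  P : (Fin N → ℝ) → Fin N → ℝ
  t : (Fin N → ℝ) → Fin N → ℝ
  measurable_P : ∀ i, Measurable (fun x => P x i)
  P_nonneg : ∀ x, (∀ j, x j ∈ Set.Icc D.lo D.hi) → ∀ i, 0 ≤ P x i
  sum_P_le_one : ∀ x, (∀ j, x j ∈ Set.Icc D.lo D.hi) → ∑ i, P x i ≤ 1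
  measurable_t : ∀ i, Measurable (fun x => t x i)
  integrable_t : ∀ i, Integrable (fun x => t x i) (D.jointLaw N)
  integrable_t_update : ∀ i, ∀ q ∈ Set.Icc D.lo D.hi,
    Integrable (fun y => t (Function.update y i q) i) (D.jointLaw N)

namespace DirectMechanism

variable {D} {N : ℕ} (M : D.DirectMechanism N)

/-- Payoff of buyer `i` over both periods when types `q` are reported and `x` are the true types:
if another buyer `k` gets the first good, the second auction is among the buyers other than `k`. -/
def payoff (q x : Fin N → ℝ) (i : Fin N) : ℝ :=
  M.P q i * x i
    + ∑ k ∈ Finset.univ.erase i, M.P q k * secondAuctionSurplus (Finset.univ.erase k) x i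
    + (1 - ∑ k, M.P q k) * secondAuctionSurplus Finset.univ x i
    - M.t q i

/-- Expected payoff of buyer `i` of type `x` who reports `q`, the others being truthful. -/
def interimPayoff (i : Fin N) (q x : ℝ) : ℝ :=
  ∫ y, M.payoff (Function.update y i q) (Function.update y i x) i ∂(D.jointLaw N)

/-- (Bayesian) incentive compatibility. -/
def IncentiveCompatible : Prop :=
  ∀ i, ∀ x ∈ Set.Icc D.lo D.hi, ∀ q ∈ Set.Icc D.lo D.hi,
    M.interimPayoff i q x ≤ M.interimPayoff i x x

/-- (Interim) individual rationality; the good is withheld if a buyer does not participate. -/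
def IndividuallyRational : Prop :=
  ∀ i, ∀ x ∈ Set.Icc D.lo D.hi, D.outsideOption i x ≤ M.interimPayoff i x x

/-- The seller's expected revenue under truthful reporting. -/
def revenue : ℝ := ∫ x, ∑ i, M.t x i ∂(D.jointLaw N)

end DirectMechanism

end ValueDistribution

end

/-!
By the envelope formula, a type's truthful payoff in an incentive compatible mechanism is the
payoff of the lowest type plus the integral of the probability of getting one of the two units.
Hence, up to the rents of the lowest types, which individual rationality makes nonnegative, the
expected payments are the expectation of the total virtual valuation that the first unit adds to
both auctions. Giving it to either of the two highest buyers adds `ψ(x₍₂₎) + x₍₂₎ - x₍₃₎`, and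
giving it to any other buyer adds no more; so the expectation of the positive part of this virtual
surplus bounds every revenue.

The bid function is chosen such that `q * A q - β q * A q` is the integral of `A` up to `q`, where
`A q` is the probability that a buyer bidding as type `q` pays his bid, that is, is the highest
bidder or gets the first unit as the second-highest. Since the rebate makes the highest bidder
indifferent about winning the second auction, this is the envelope payoff of the direct mechanism
that the auction implements. That mechanism is incentive compatible because a misreport `q` of
type `z` wins a unit with probability at most `A z` for `q ≤ z`, and at least `A z` for `z ≤ q`.
Reports of the lowest type yield the outside option, so no rent is left and the revenue bound is
attained. Finally, a bid outside the range of `β` does no better than the bid of the type that is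
inferred from it.
-/

/-! ### Order statistics and subgradients -/

section OrderStatistics

variable {ι : Type*} {s : Finset ι} {v w : ι → ℝ} {k : ℕ}

lemma exists_forall_le_card_filter_iff (hk : 1 ≤ k) (hks : k ≤ s.card) (v : ι → ℝ) :
    ∃ j ∈ s, ∀ t, k ≤ (s.filter (fun i => t ≤ v i)).card ↔ t ≤ v j := by
  have hne : (s.filter fun j => k ≤ (s.filter (fun i => v j ≤ v i)).card).Nonempty := by
    obtain ⟨j, hj, hmin⟩ := s.exists_min_image v (Finset.card_pos.mp (by omega))
    exact ⟨j, Finset.mem_filter.mpr ⟨hj, by rwa [Finset.filter_true_of_mem hmin]⟩⟩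
  obtain ⟨j, hj, hmax⟩ := Finset.exists_max_image _ v hne
  rw [Finset.mem_filter] at hj
  refine ⟨j, hj.1, fun t => ⟨fun ht => ?_, fun ht => ?_⟩⟩
  · obtain ⟨l, hl, hlmin⟩ := Finset.exists_min_image (s.filter fun i => t ≤ v i) v
      (Finset.card_pos.mp (by omega))
    rw [Finset.mem_filter] at hl
    refine hl.2.trans (hmax l (Finset.mem_filter.mpr ⟨hl.1, ht.trans (Finset.card_le_card ?_)⟩))
    exact fun i hi => Finset.mem_filter.mpr ⟨Finset.mem_of_mem_filter i hi, hlmin i hi⟩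
  · exact hj.2.trans (Finset.card_le_card (Finset.monotone_filter_right s fun _ _ => ht.trans))

lemma kthHighest_eq_of_forall_iff {c : ℝ}
    (h : ∀ t, k ≤ (s.filter (fun i => t ≤ v i)).card ↔ t ≤ c) : kthHighest s v k = c := by
  simp only [kthHighest, h]
  exact csSup_Iic

lemma exists_kthHighest_eq (hk : 1 ≤ k) (hks : k ≤ s.card) (v : ι → ℝ) :
    ∃ j ∈ s, kthHighest s v k = v j := by
  obtain ⟨j, hj, h⟩ := exists_forall_le_card_filter_iff hk hks v
  exact ⟨j, hj, kthHighest_eq_of_forall_iff h⟩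

lemma le_kthHighest_iff (hk : 1 ≤ k) (hks : k ≤ s.card) {t : ℝ} :
    t ≤ kthHighest s v k ↔ k ≤ (s.filter (fun i => t ≤ v i)).card := by
  obtain ⟨j, -, h⟩ := exists_forall_le_card_filter_iff hk hks v
  rw [kthHighest_eq_of_forall_iff h, h]

lemma kthHighest_mem (hk : 1 ≤ k) (hks : k ≤ s.card) {A : Set ℝ} (h : ∀ j ∈ s, v j ∈ A) :
    kthHighest s v k ∈ A := by
  obtain ⟨j, hj, hv⟩ := exists_kthHighest_eq hk hks v
  exact hv ▸ h j hj

lemma kthHighest_congr (h : ∀ i ∈ s, v i = w i) : kthHighest s v k = kthHighest s w k := by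
  unfold kthHighest
  congr! 4 with t
  rw [Finset.filter_congr fun i hi => by rw [h i hi]]

lemma kthHighest_erase_update [DecidableEq ι] (i : ι) (z : ℝ) :
    kthHighest (s.erase i) (Function.update v i z) k = kthHighest (s.erase i) v k :=
  kthHighest_congr fun _ hj => Function.update_of_ne (Finset.ne_of_mem_erase hj) _ _

lemma kthHighest_card_of_subset {U : Finset ι} (hU : U ⊆ s) {b : ι} (hb : b ∈ U)
    (h₁ : ∀ j ∈ U, v b ≤ v j) (h₂ : ∀ j ∈ s, j ∉ U → v j ≤ v b) :
    kthHighest s v U.card = v b := by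
  classical
  refine kthHighest_eq_of_forall_iff fun t => ⟨fun ht => ?_, fun ht => ?_⟩
  · by_contra! hlt
    have hsub : s.filter (fun i => t ≤ v i) ⊆ U.erase b := by
      intro i hi
      rw [Finset.mem_filter] at hi
      have hiU : i ∈ U := by
        by_contra hiU
        exact absurd (hi.2.trans (h₂ i hi.1 hiU)) hlt.not_ge
      exact Finset.mem_erase.mpr ⟨fun hib => hlt.not_ge (hib ▸ hi.2), hiU⟩
    exact ht.not_gt ((Finset.card_le_card hsub).trans_lt (Finset.card_erase_lt_of_mem hb))
  · exact Finset.card_le_card fun i hi => Finset.mem_filter.mpr ⟨hU hi, ht.trans (h₁ i hi)⟩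

lemma kthHighest_one_eq {a : ι} (ha : a ∈ s) (h : ∀ j ∈ s, v j ≤ v a) :
    kthHighest s v 1 = v a := by
  rw [← Finset.card_singleton a]
  exact kthHighest_card_of_subset (Finset.singleton_subset_iff.mpr ha) (Finset.mem_singleton_self a)
    (fun j hj => (Finset.mem_singleton.mp hj ▸ le_rfl)) fun j hj _ => h j hj

lemma kthHighest_two_eq {a b : ι} (ha : a ∈ s) (hb : b ∈ s) (hab : a ≠ b) (hba : v b ≤ v a)
    (h : ∀ j ∈ s, j ≠ a → v j ≤ v b) : kthHighest s v 2 = v b := by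
  classical
  rw [← Finset.card_pair hab]
  refine kthHighest_card_of_subset ?_ (by simp) ?_ fun j hj hU => h j hj (by grind)
  · grind
  · grind

lemma kthHighest_three_eq {a b c : ι} (ha : a ∈ s) (hb : b ∈ s) (hc : c ∈ s) (hab : a ≠ b)
    (hac : a ≠ c) (hbc : b ≠ c) (hba : v b ≤ v a) (hcb : v c ≤ v b)
    (h : ∀ j ∈ s, j ≠ a → j ≠ b → v j ≤ v c) : kthHighest s v 3 = v c := by
  classical
  rw [← Finset.card_eq_three.mpr ⟨a, b, c, hab, hac, hbc, rfl⟩]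
  refine kthHighest_card_of_subset ?_ (by simp) ?_ fun j hj hU => h j hj (by grind) (by grind)
  · grind
  · grind

lemma measurable_kthHighest (hk : 1 ≤ k) (hks : k ≤ s.card) :
    Measurable fun v : ι → ℝ => kthHighest s v k := by
  refine measurable_of_Ici fun t => ?_
  have hpre : (fun v : ι → ℝ => kthHighest s v k) ⁻¹' Set.Ici t =
      {v | k ≤ ∑ i ∈ s, if t ≤ v i then 1 else 0} := by
    ext v
    rw [Set.mem_preimage, Set.mem_Ici, le_kthHighest_iff hk hks, Finset.card_filter]
    rfl
  rw [hpre]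
  refine measurableSet_le measurable_const (Finset.measurable_sum _ fun i _ => ?_)
  exact Measurable.ite (measurableSet_le measurable_const (measurable_pi_apply i))
    measurable_const measurable_const

/-- `a` and `b` have the highest and the second-highest of the numbers `v i`, `i ∈ s`, and are not
tied with each other. Ties for the second place are allowed. -/
structure IsTopTwo (s : Finset ι) (v : ι → ℝ) (a b : ι) : Prop where
  left_mem : a ∈ s
  right_mem : b ∈ s
  lt : v b < v a
  le_right : ∀ ⦃j⦄, j ∈ s → j ≠ a → v j ≤ v b

namespace IsTopTwo

variable {a b c i j : ι}

lemma ne (h : IsTopTwo s v a b) : a ≠ b := fun hab => (hab ▸ h.lt).false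

lemma le_left (h : IsTopTwo s v a b) (hj : j ∈ s) : v j ≤ v a := by
  rcases eq_or_ne j a with rfl | hja
  · rfl
  · exact (h.le_right hj hja).trans h.lt.le

lemma kthHighest_one (h : IsTopTwo s v a b) : kthHighest s v 1 = v a :=
  kthHighest_one_eq h.left_mem fun _ => h.le_left

lemma kthHighest_two (h : IsTopTwo s v a b) : kthHighest s v 2 = v b :=
  kthHighest_two_eq h.left_mem h.right_mem h.ne h.lt.le fun _ hj => h.le_right hj

variable [DecidableEq ι]

lemma kthHighest_three (h : IsTopTwo s v a b) (h' : IsTopTwo (s.erase a) v b c) :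
    kthHighest s v 3 = v c :=
  kthHighest_three_eq h.left_mem h.right_mem (Finset.mem_of_mem_erase h'.right_mem) h.ne
    (Finset.ne_of_mem_erase h'.right_mem).symm h'.ne h.lt.le h'.lt.le
    fun _ hj hja => h'.le_right (Finset.mem_erase.mpr ⟨hja, hj⟩)

lemma kthHighest_erase_left_one (h : IsTopTwo s v a b) : kthHighest (s.erase a) v 1 = v b :=
  kthHighest_one_eq (Finset.mem_erase.mpr ⟨h.ne.symm, h.right_mem⟩)
    fun _ hj => h.le_right (Finset.mem_of_mem_erase hj) (Finset.ne_of_mem_erase hj)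

lemma kthHighest_erase_one_of_ne (h : IsTopTwo s v a b) (hi : i ≠ a) :
    kthHighest (s.erase i) v 1 = v a :=
  kthHighest_one_eq (Finset.mem_erase.mpr ⟨hi.symm, h.left_mem⟩)
    fun _ hj => h.le_left (Finset.mem_of_mem_erase hj)

lemma kthHighest_erase_one_lt_iff (h : IsTopTwo s v a b) (hi : i ∈ s) :
    kthHighest (s.erase i) v 1 < v i ↔ i = a := by
  rcases eq_or_ne i a with rfl | hia
  · simpa only [h.kthHighest_erase_left_one, iff_true] using h.lt
  · simpa only [h.kthHighest_erase_one_of_ne hia, hia, iff_false, not_lt] using h.le_left hi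

lemma erase_of_ne (h : IsTopTwo s v a b) (ha : i ≠ a) (hb : i ≠ b) :
    IsTopTwo (s.erase i) v a b where
  left_mem := Finset.mem_erase.mpr ⟨ha.symm, h.left_mem⟩
  right_mem := Finset.mem_erase.mpr ⟨hb.symm, h.right_mem⟩
  lt := h.lt
  le_right _ hj := h.le_right (Finset.mem_of_mem_erase hj)

lemma erase_right (h : IsTopTwo s v a b) (h' : IsTopTwo (s.erase a) v b c) :
    IsTopTwo (s.erase b) v a c where
  left_mem := Finset.mem_erase.mpr ⟨h.ne, h.left_mem⟩
  right_mem := Finset.mem_erase.mpr ⟨h'.ne.symm, Finset.mem_of_mem_erase h'.right_mem⟩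
  lt := h'.lt.trans h.lt
  le_right _ hj hja := h'.le_right
    (Finset.mem_erase.mpr ⟨hja, Finset.mem_of_mem_erase hj⟩) (Finset.ne_of_mem_erase hj)

end IsTopTwo

lemma exists_isTopTwo (hs : 2 ≤ s.card) (hv : Set.InjOn v s) : ∃ a b, IsTopTwo s v a b := by
  classical
  obtain ⟨a, ha, hmax⟩ := s.exists_max_image v (Finset.card_pos.mp (by omega))
  obtain ⟨b, hb, hmaxb⟩ := (s.erase a).exists_max_image v
    (Finset.card_pos.mp (by rw [Finset.card_erase_of_mem ha]; omega))
  obtain ⟨hba, hbs⟩ := Finset.mem_erase.mp hb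
  exact ⟨a, b, ha, hbs, (hmax b hbs).lt_of_ne fun h => hba (hv hbs ha h),
    fun j hj hja => hmaxb j (Finset.mem_erase.mpr ⟨hja, hj⟩)⟩

lemma exists_isTopTwo_isTopTwo_erase [DecidableEq ι] (hs : 3 ≤ s.card) (hv : Set.InjOn v s) :
    ∃ a b c, IsTopTwo s v a b ∧ IsTopTwo (s.erase a) v b c := by
  obtain ⟨a, b, hab⟩ := exists_isTopTwo (by omega) hv
  obtain ⟨b', c, hbc⟩ := exists_isTopTwo (s := s.erase a)
    (by rw [Finset.card_erase_of_mem hab.left_mem]; omega) (hv.mono (Finset.erase_subset a s))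
  have hb' := Finset.mem_erase.mp hbc.left_mem
  obtain rfl : b' = b := hv hb'.2 hab.right_mem <| (hab.le_right hb'.2 hb'.1).antisymm <|
    hbc.le_left (Finset.mem_erase.mpr ⟨hab.ne.symm, hab.right_mem⟩)
  exact ⟨a, b', c, hab, hbc⟩

end OrderStatistics

lemma pow_add_mul_lt_pow {a b : ℝ} (ha : 0 ≤ a) (hab : a < b) {n : ℕ} (hn : 2 ≤ n) :
    a ^ n + n * a ^ (n - 1) * (b - a) < b ^ n := by
  induction n, hn using Nat.le_induction with
  | base => norm_num; nlinarith
  | succ n hn ih =>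
    obtain ⟨m, rfl⟩ : ∃ m, n = m + 1 := ⟨n - 1, by omega⟩
    simp only [Nat.add_sub_cancel] at ih ⊢
    calc a ^ (m + 1 + 1) + ((m + 1 + 1 : ℕ) : ℝ) * a ^ (m + 1) * (b - a)
        ≤ (a ^ (m + 1) + ((m + 1 : ℕ) : ℝ) * a ^ m * (b - a)) * b := by
          have : 0 ≤ ((m : ℝ) + 1) * a ^ m * (b - a) ^ 2 := by positivity
          push_cast
          linear_combination this
      _ < b ^ (m + 1) * b := mul_lt_mul_of_pos_right ih (ha.trans_lt hab)
      _ = b ^ (m + 1 + 1) := (pow_succ _ _).symm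

/-- `w x` is a subgradient at `x`, relative to `s`, of the function `V`, for every `x ∈ s`. In a
direct mechanism `V` will be the truthful payoff and `w` the probability of getting a unit. -/
def IsSubgradientOn (w V : ℝ → ℝ) (s : Set ℝ) : Prop :=
  ∀ x ∈ s, ∀ z ∈ s, V x + (z - x) * w x ≤ V z

namespace IsSubgradientOn

variable {V w : ℝ → ℝ} {s : Set ℝ} {a b x z : ℝ}

lemma mono {t : Set ℝ} (h : IsSubgradientOn w V s) (hts : t ⊆ s) : IsSubgradientOn w V t :=
  fun x hx z hz => h x (hts hx) z (hts hz)

lemma monotoneOn (h : IsSubgradientOn w V s) : MonotoneOn w s := by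
  intro x hx z hz hxz
  rcases hxz.eq_or_lt with rfl | hlt
  · rfl
  · nlinarith [h x hx z hz, h z hz x hx]

lemma abs_sub_sub_mul_le (h : IsSubgradientOn w V s) (hx : x ∈ s) (hz : z ∈ s) :
    |V z - V x - (z - x) * w x| ≤ |z - x| * |w z - w x| := by
  rw [abs_of_nonneg (by linarith [h x hx z hz]), ← abs_mul]
  exact le_trans (by linarith [h z hz x hx]) (le_abs_self _)

lemma continuousOn_Icc (h : IsSubgradientOn w V (Set.Icc a b)) : ContinuousOn V (Set.Icc a b) := by
  rcases lt_or_ge b a with hba | hab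
  · simp [Set.Icc_eq_empty hba.not_ge]
  have hLip : ∀ x ∈ Set.Icc a b, ∀ z ∈ Set.Icc a b, V z - V x ≤ max |w a| |w b| * |z - x| := by
    intro x hx z hz
    have hwa := h.monotoneOn (Set.left_mem_Icc.mpr hab) hz hz.1
    have hwb := h.monotoneOn hz (Set.right_mem_Icc.mpr hab) hz.2
    calc V z - V x ≤ w z * (z - x) := by linarith [h z hz x hx]
      _ ≤ |w z| * |z - x| := by rw [← abs_mul]; exact le_abs_self _
      _ ≤ max |w a| |w b| * |z - x| := by gcongr; exact abs_le_max_abs_abs hwa hwb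
  refine (LipschitzOnWith.of_dist_le_mul (K := (max |w a| |w b|).toNNReal)
    fun z hz x hx => ?_).continuousOn
  rw [Real.coe_toNNReal _ (le_max_of_le_left (abs_nonneg _)), Real.dist_eq, Real.dist_eq]
  exact abs_sub_le_iff.mpr ⟨hLip x hx z hz, abs_sub_comm z x ▸ hLip z hz x hx⟩

lemma hasDerivAt (h : IsSubgradientOn w V s) (hs : s ∈ nhds x) (hw : ContinuousAt w x) :
    HasDerivAt V (w x) x := by
  rw [hasDerivAt_iff_isLittleO, Asymptotics.isLittleO_iff]
  intro c hc
  filter_upwards [hs, Metric.continuousAt_iff'.mp hw c hc] with z hz hwz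
  rw [smul_eq_mul, Real.norm_eq_abs, Real.norm_eq_abs, mul_comm c]
  exact (h.abs_sub_sub_mul_le (mem_of_mem_nhds hs) hz).trans
    (mul_le_mul_of_nonneg_left hwz.le (abs_nonneg _))

lemma integral_eq_sub (hab : a ≤ b) (h : IsSubgradientOn w V (Set.Icc a b)) :
    ∫ z in a..b, w z = V b - V a := by
  refine integral_eq_of_hasDerivAt_off_countable_of_le V w hab
    h.monotoneOn.countable_not_continuousWithinAt h.continuousOn_Icc ?_
    (Set.uIcc_of_le hab ▸ h.monotoneOn).intervalIntegrable
  rintro x ⟨hx, hcont⟩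
  have hnhds : Set.Icc a b ∈ nhds x := Icc_mem_nhds hx.1 hx.2
  refine h.hasDerivAt hnhds (ContinuousWithinAt.continuousAt ?_ hnhds)
  by_contra hdisc
  exact hcont ⟨Set.Ioo_subset_Icc_self hx, hdisc⟩

end IsSubgradientOn

lemma isSubgradientOn_integral {Ω : Type*} [MeasurableSpace Ω] {μ : Measure Ω} {w V : Ω → ℝ → ℝ}
    {s : Set ℝ} (h : ∀ᵐ ω ∂μ, IsSubgradientOn (w ω) (V ω) s)
    (hw : ∀ x ∈ s, Integrable (fun ω => w ω x) μ) (hV : ∀ x ∈ s, Integrable (fun ω => V ω x) μ) :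
    IsSubgradientOn (fun x => ∫ ω, w ω x ∂μ) (fun x => ∫ ω, V ω x ∂μ) s := by
  intro x hx z hz
  rw [← integral_const_mul, ← integral_add (hV x hx) ((hw x hx).const_mul _)]
  refine integral_mono_ae ((hV x hx).add ((hw x hx).const_mul _)) (hV z hz) ?_
  filter_upwards [h] with ω hω using hω x hx z hz

section ProductMeasure

variable {ι : Type*} [Fintype ι] [DecidableEq ι]

lemma measurePreserving_update_pi {X : ι → Type*} [∀ i, MeasurableSpace (X i)]
    (μ : ∀ i, Measure (X i)) [∀ i, IsProbabilityMeasure (μ i)] (i : ι) :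
    MeasurePreserving (fun p : X i × (∀ j, X j) => Function.update p.2 i p.1)
      ((μ i).prod (Measure.pi μ)) (Measure.pi μ) := by
  have hmeas : Measurable fun p : X i × (∀ j, X j) => Function.update p.2 i p.1 :=
    measurable_update'.comp measurable_swap
  refine ⟨hmeas, (Measure.pi_eq fun s hs => ?_).symm⟩
  have hpre : (fun p : X i × (∀ j, X j) => Function.update p.2 i p.1) ⁻¹' Set.univ.pi s =
      s i ×ˢ Set.univ.pi (Function.update s i Set.univ) := by
    ext p
    simp only [Set.mem_preimage, Set.mem_univ_pi, Set.mem_prod]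
    refine ⟨fun h => ⟨by simpa using h i, fun j => ?_⟩, fun h j => ?_⟩
    · rcases eq_or_ne j i with rfl | hj
      · simp
      · simpa [hj] using h j
    · rcases eq_or_ne j i with rfl | hj
      · simpa using h.1
      · simpa [hj] using h.2 j
  rw [Measure.map_apply hmeas (MeasurableSet.univ_pi hs), hpre, Measure.prod_prod, Measure.pi_pi,
    ← Finset.mul_prod_erase Finset.univ (fun j => μ j (s j)) (Finset.mem_univ i),
    ← Finset.mul_prod_erase Finset.univ _ (Finset.mem_univ i), Function.update_self, measure_univ,
    one_mul]
  congr 1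
  exact Finset.prod_congr rfl fun j hj => by rw [Function.update_of_ne (Finset.ne_of_mem_erase hj)]

lemma integral_pi_eq_integral_update {X : ι → Type*} [∀ i, MeasurableSpace (X i)]
    (μ : ∀ i, Measure (X i)) [∀ i, IsProbabilityMeasure (μ i)] (i : ι) {g : (∀ j, X j) → ℝ}
    (hg : Integrable g (Measure.pi μ)) :
    ∫ x, g x ∂Measure.pi μ = ∫ z, ∫ y, g (Function.update y i z) ∂Measure.pi μ ∂μ i := by
  have hp := measurePreserving_update_pi μ i
  rw [← integral_prod (fun p : X i × (∀ j, X j) => g (Function.update p.2 i p.1))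
      (hp.integrable_comp_of_integrable hg),
    ← integral_map (f := g) hp.measurable.aemeasurable
      (by rw [hp.map_eq]; exact hg.aestronglyMeasurable), hp.map_eq]

omit [DecidableEq ι] in
lemma ae_injective_pi {X : Type*} [MeasurableSpace X] [MeasurableEq X]
    (μ : Measure X) [IsProbabilityMeasure μ] [NullSingletonClass μ] :
    ∀ᵐ x ∂Measure.pi fun _ : ι => μ, Function.Injective x := by
  classical
  have hne : ∀ i j : ι, i ≠ j → ∀ᵐ x ∂Measure.pi fun _ : ι => μ, x i ≠ x j := by
    intro i j hij
    have hm : MeasurableSet {x : ι → X | x i ≠ x j} :=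
      (measurableSet_eq_fun (measurable_pi_apply i) (measurable_pi_apply j)).compl
    have hp := measurePreserving_update_pi (fun _ : ι => μ) i
    rw [← hp.map_eq]
    refine (ae_map_iff hp.measurable.aemeasurable hm).mpr
      ((Measure.ae_prod_iff_ae_ae (hp.measurable hm)).mpr ?_)
    refine (Measure.ae_ae_comm (p := fun z y => Function.update y i z ∈ {x : ι → X | x i ≠ x j})
      (hp.measurable hm)).mpr (ae_of_all _ fun y => ?_)
    simp only [Set.mem_ofPred_eq, Function.update_self, Function.update_of_ne hij.symm]
    exact (Set.countable_singleton (y j)).ae_notMem μ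
  filter_upwards [ae_all_iff.mpr fun i => ae_all_iff.mpr fun j =>
    Filter.eventually_imp_distrib_left.mpr (hne i j)] with x hx i j hij
  exact of_not_not fun hij' => hx i j hij' hij

end ProductMeasure

/-! ### The valuation distribution -/

namespace ValueDistribution

variable (D : ValueDistribution) {N : ℕ}

section Law

lemma lo_mem_Icc : D.lo ∈ Set.Icc D.lo D.hi := Set.left_mem_Icc.mpr D.lo_lt_hi.le

lemma measurable_f : Measurable D.f := by
  classical
  have hf : D.f = (Set.Icc D.lo D.hi).piecewise D.f (fun _ => 0) := by
    ext x
    by_cases hx : x ∈ Set.Icc D.lo D.hi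
    · rw [Set.piecewise_eq_of_mem _ _ _ hx]
    · rw [Set.piecewise_eq_of_notMem _ _ _ hx, D.f_eq_zero x hx]
  rw [hf]
  exact D.continuousOn_f.measurable_piecewise continuousOn_const measurableSet_Icc

lemma integrable_f : Integrable D.f :=
  (integrableOn_iff_integrable_of_support_subset fun x hx =>
    of_not_not fun hx' => hx (D.f_eq_zero x hx')).mp D.continuousOn_f.integrableOn_Icc

lemma intervalIntegrable_f (a b : ℝ) : IntervalIntegrable D.f volume a b :=
  D.integrable_f.intervalIntegrable

lemma continuousAt_f {x : ℝ} (hlo : x ≠ D.lo) (hhi : x ≠ D.hi) : ContinuousAt D.f x := by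
  by_cases hx : x ∈ Set.Icc D.lo D.hi
  · exact D.continuousOn_f.continuousAt
      (Icc_mem_nhds (hx.1.lt_of_ne' hlo) (hx.2.lt_of_ne hhi))
  · refine (continuousAt_const (y := (0 : ℝ))).congr ?_
    filter_upwards [isClosed_Icc.isOpen_compl.mem_nhds hx] with t ht using (D.f_eq_zero t ht).symm

lemma law_real_eq_setIntegral {s : Set ℝ} (hs : MeasurableSet s) :
    D.law.real s = ∫ t in s, D.f t := by
  rw [Measure.real, law, withDensity_apply _ hs,
    integral_eq_lintegral_of_nonneg_ae (ae_of_all _ D.f_nonneg)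
      D.measurable_f.aestronglyMeasurable]

lemma setIntegral_Icc_mul_f (g : ℝ → ℝ) :
    ∫ x in Set.Icc D.lo D.hi, g x * D.f x = ∫ x, g x * D.f x :=
  setIntegral_eq_integral_of_forall_compl_eq_zero fun x hx => by rw [D.f_eq_zero x hx, mul_zero]

lemma integral_law (g : ℝ → ℝ) : ∫ x, g x ∂D.law = ∫ x in D.lo..D.hi, g x * D.f x := by
  rw [law, integral_withDensity_eq_integral_toReal_smul D.measurable_f.ennreal_ofReal
    (by simp), intervalIntegral.integral_of_le D.lo_lt_hi.le, ← integral_Icc_eq_integral_Ioc,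
    setIntegral_Icc_mul_f]
  simp only [ENNReal.toReal_ofReal (D.f_nonneg _), smul_eq_mul, mul_comm]

lemma integrable_law_iff {g : ℝ → ℝ} :
    Integrable g D.law ↔ Integrable (fun x => g x * D.f x) := by
  rw [law, integrable_withDensity_iff D.measurable_f.ennreal_ofReal (by simp)]
  simp only [ENNReal.toReal_ofReal (D.f_nonneg _)]

lemma law_real_Ioo : D.law.real (Set.Ioo D.lo D.hi) = 1 := by
  rw [D.law_real_eq_setIntegral measurableSet_Ioo, ← integral_Ioc_eq_integral_Ioo,
    ← intervalIntegral.integral_of_le D.lo_lt_hi.le, D.integral_f]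

instance : IsProbabilityMeasure D.law := by
  rw [isProbabilityMeasure_iff_real, D.law_real_eq_setIntegral MeasurableSet.univ,
    Measure.restrict_univ]
  have hIcc := D.setIntegral_Icc_mul_f fun _ => 1
  simp only [one_mul] at hIcc
  rw [← hIcc, integral_Icc_eq_integral_Ioc, ← intervalIntegral.integral_of_le D.lo_lt_hi.le,
    D.integral_f]

instance : NullSingletonClass D.law := by unfold law; infer_instance

lemma ae_mem_Ioo : ∀ᵐ x ∂D.law, x ∈ Set.Ioo D.lo D.hi := by
  refine (mem_ae_iff_prob_eq_one measurableSet_Ioo).mpr ?_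
  rw [← ofReal_measureReal, D.law_real_Ioo, ENNReal.ofReal_one]

lemma law_real_Ioi (x : ℝ) : D.law.real (Set.Ioi x) = 1 - D.F x := by
  rw [F, ← Set.compl_Iic, probReal_compl_eq_one_sub measurableSet_Iic]

lemma law_real_Iio (x : ℝ) : D.law.real (Set.Iio x) = D.F x :=
  measureReal_congr Iio_ae_eq_Iic

end Law

section DistributionFunction

lemma F_mono : Monotone D.F := fun _ _ h => measureReal_mono (Set.Iic_subset_Iic.mpr h)

lemma F_nonneg (x : ℝ) : 0 ≤ D.F x := measureReal_nonneg

lemma F_le_one (x : ℝ) : D.F x ≤ 1 := measureReal_le_one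

lemma F_sub_F_eq_integral (x y : ℝ) : D.F y - D.F x = ∫ t in x..y, D.f t := by
  simp only [F, D.law_real_eq_setIntegral measurableSet_Iic]
  exact intervalIntegral.integral_Iic_sub_Iic D.integrable_f.integrableOn
    D.integrable_f.integrableOn

lemma F_lo : D.F D.lo = 0 := by
  rw [← law_real_Iio, D.law_real_eq_setIntegral measurableSet_Iio]
  exact setIntegral_eq_zero_of_forall_eq_zero fun t ht => D.f_eq_zero t fun h => h.1.not_gt ht

lemma F_of_le_lo {x : ℝ} (hx : x ≤ D.lo) : D.F x = 0 :=
  le_antisymm (D.F_lo ▸ D.F_mono hx) (D.F_nonneg x)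

lemma F_eq_integral (x : ℝ) : D.F x = ∫ t in D.lo..x, D.f t := by
  rw [← F_sub_F_eq_integral, F_lo, sub_zero]

lemma F_hi : D.F D.hi = 1 := by rw [F_eq_integral, D.integral_f]

lemma F_strictMonoOn : StrictMonoOn D.F (Set.Icc D.lo D.hi) := by
  intro x hx y hy hxy
  rw [← sub_pos, F_sub_F_eq_integral]
  exact intervalIntegral.intervalIntegral_pos_of_pos_on (D.intervalIntegrable_f _ _)
    (fun t ht => D.f_pos t ⟨hx.1.trans_lt ht.1, ht.2.trans_le hy.2⟩) hxy

lemma F_pos {x : ℝ} (hx : D.lo < x) : 0 < D.F x := by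
  rcases le_total x D.hi with h | h
  · exact D.F_lo ▸ D.F_strictMonoOn D.lo_mem_Icc ⟨hx.le, h⟩ hx
  · exact (D.F_hi ▸ zero_lt_one : 0 < D.F D.hi).trans_le (D.F_mono h)

lemma continuous_F : Continuous D.F := by
  rw [funext D.F_eq_integral]
  exact intervalIntegral.continuous_primitive D.intervalIntegrable_f D.lo

lemma hasDerivAt_F {x : ℝ} (hlo : x ≠ D.lo) (hhi : x ≠ D.hi) : HasDerivAt D.F (D.f x) x := by
  rw [funext D.F_eq_integral]
  exact intervalIntegral.integral_hasDerivAt_right (D.intervalIntegrable_f _ _)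
    D.measurable_f.stronglyMeasurable.stronglyMeasurableAtFilter (D.continuousAt_f hlo hhi)

end DistributionFunction

section VirtualValuation

lemma measurable_psi : Measurable D.psi :=
  measurable_id.sub ((measurable_const.sub D.continuous_F.measurable).div D.measurable_f)

lemma continuousAt_psi {x : ℝ} (hx : x ∈ Set.Ioo D.lo D.hi) : ContinuousAt D.psi x :=
  continuousAt_id.sub ((continuousAt_const.sub D.continuous_F.continuousAt).div
    (D.continuousAt_f hx.1.ne' hx.2.ne) (D.f_pos x hx).ne')

lemma psi_le_self (x : ℝ) : D.psi x ≤ x :=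
  sub_le_self _ (div_nonneg (sub_nonneg.mpr (D.F_le_one x)) (D.f_nonneg x))

lemma psi_hi : D.psi D.hi = D.hi := by rw [psi, F_hi, sub_self, zero_div, sub_zero]

variable {D}

lemma psi_monotoneOn_Ioc (hψ : MonotoneOn D.psi (Set.Ioo D.lo D.hi)) :
    MonotoneOn D.psi (Set.Ioc D.lo D.hi) := by
  intro x hx y hy hxy
  rcases hy.2.eq_or_lt with rfl | h
  · exact D.psi_hi.symm ▸ (D.psi_le_self x).trans hxy
  · exact hψ ⟨hx.1, hxy.trans_lt h⟩ ⟨hy.1, h⟩ hxy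

end VirtualValuation

section JointLaw

instance (N : ℕ) : IsProbabilityMeasure (D.jointLaw N) := by unfold jointLaw; infer_instance

lemma integral_jointLaw_eq_integral_update (i : Fin N) {g : (Fin N → ℝ) → ℝ}
    (hg : Integrable g (D.jointLaw N)) :
    ∫ x, g x ∂D.jointLaw N = ∫ z, ∫ y, g (Function.update y i z) ∂D.jointLaw N ∂D.law :=
  integral_pi_eq_integral_update (fun _ => D.law) i hg

lemma measurePreserving_eval (i : Fin N) :
    MeasurePreserving (fun x : Fin N → ℝ => x i) (D.jointLaw N) D.law :=
  MeasureTheory.measurePreserving_eval (fun _ => D.law) i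

lemma jointLaw_real_univ_pi (s : Fin N → Set ℝ) :
    (D.jointLaw N).real (Set.univ.pi s) = ∏ j, D.law.real (s j) := by
  simp only [Measure.real, jointLaw, Measure.pi_pi, ENNReal.toReal_prod]

lemma ae_forall_mem_Ioo : ∀ᵐ x ∂D.jointLaw N, ∀ j, x j ∈ Set.Ioo D.lo D.hi :=
  ae_all_iff.mpr fun j => (D.measurePreserving_eval j).quasiMeasurePreserving.ae D.ae_mem_Ioo

lemma ae_forall_mem_Icc : ∀ᵐ x ∂D.jointLaw N, ∀ j, x j ∈ Set.Icc D.lo D.hi := by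
  filter_upwards [D.ae_forall_mem_Ioo] with x hx j using Set.Ioo_subset_Icc_self (hx j)

lemma ae_forall_ne (q : ℝ) : ∀ᵐ x ∂D.jointLaw N, ∀ j, x j ≠ q :=
  ae_all_iff.mpr fun j => (D.measurePreserving_eval j).quasiMeasurePreserving.ae
    ((Set.countable_singleton q).ae_notMem D.law)

lemma ae_injective : ∀ᵐ x ∂D.jointLaw N, Function.Injective x := ae_injective_pi D.law

end JointLaw

section PayProb

/-- The largest value of the second-highest rival type against which type `q` gets the first unit,
at the price of his bid, when he has the second-highest type. -/
noncomputable def payThreshold (q : ℝ) : ℝ := min q (q + D.psi q)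

/-- The probability that type `q` pays his bid, as one formula for the three cases of `H`. -/
noncomputable def payProb (N : ℕ) (q : ℝ) : ℝ :=
  D.F q ^ (N - 1) + ((N : ℝ) - 1) * D.F (D.payThreshold q) ^ (N - 2) * (1 - D.F q)

lemma F_payThreshold_le (q : ℝ) : D.F (D.payThreshold q) ≤ D.F q := D.F_mono (min_le_left _ _)

lemma payThreshold_monotoneOn {D : ValueDistribution}
    (hψ : MonotoneOn D.psi (Set.Ioo D.lo D.hi)) :
    MonotoneOn D.payThreshold (Set.Ioc D.lo D.hi) := fun _ hx _ hy hxy =>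
  min_le_min hxy (add_le_add hxy (psi_monotoneOn_Ioc hψ hx hy hxy))

lemma payProb_of_psi_nonneg {q : ℝ} (h : 0 ≤ D.psi q) : D.payProb N q = D.G₂ N q := by
  rw [payProb, G₂, payThreshold, min_eq_left (le_add_of_nonneg_right h)]

lemma payProb_of_psi_nonpos {q : ℝ} (h : D.psi q ≤ 0) : D.payProb N q =
    D.G₁ N q + ((N : ℝ) - 1) * D.F (q + D.psi q) ^ (N - 2) * (1 - D.F q) := by
  rw [payProb, G₁, payThreshold, min_eq_right (add_le_of_nonpos_right h)]

variable (hN : 3 ≤ N)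
include hN

lemma payProb_of_add_psi_le_lo {q : ℝ} (h : q + D.psi q ≤ D.lo) : D.payProb N q = D.G₁ N q := by
  rw [payProb, G₁, payThreshold, D.F_of_le_lo ((min_le_right _ _).trans h), zero_pow (by omega),
    mul_zero, zero_mul, add_zero]

omit D in
lemma natCast_sub_one_pos : (0 : ℝ) < (N : ℝ) - 1 :=
  sub_pos.mpr (Nat.one_lt_cast.mpr (by omega))

lemma G₁_lo : D.G₁ N D.lo = 0 := by rw [G₁, F_lo, zero_pow (by omega)]

lemma G₂_lo : D.G₂ N D.lo = 0 := by
  rw [G₂, F_lo, zero_pow (by omega), zero_pow (by omega), mul_zero, zero_mul, add_zero]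

lemma payProb_le_G₂ (q : ℝ) : D.payProb N q ≤ D.G₂ N q := by
  have hpow := pow_le_pow_left₀ (D.F_nonneg _) (D.F_payThreshold_le q) (N - 2)
  have hN' := natCast_sub_one_pos hN
  have hF := sub_nonneg.mpr (D.F_le_one q)
  unfold payProb G₂
  gcongr

lemma G₁_le_payProb (q : ℝ) : D.G₁ N q ≤ D.payProb N q :=
  le_add_of_nonneg_right (mul_nonneg (mul_nonneg (natCast_sub_one_pos hN).le
    (pow_nonneg (D.F_nonneg _) _)) (sub_nonneg.mpr (D.F_le_one q)))

lemma payProb_lo : D.payProb N D.lo = 0 :=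
  le_antisymm (D.G₂_lo hN ▸ D.payProb_le_G₂ hN D.lo) (D.G₁_lo hN ▸ D.G₁_le_payProb hN D.lo)

lemma payProb_nonneg (q : ℝ) : 0 ≤ D.payProb N q :=
  (pow_nonneg (D.F_nonneg q) _).trans (D.G₁_le_payProb hN q)

lemma payProb_pos {q : ℝ} (hq : D.lo < q) : 0 < D.payProb N q :=
  (pow_pos (D.F_pos hq) _).trans_le (D.G₁_le_payProb hN q)

lemma payProb_strictMonoOn (hψ : MonotoneOn D.psi (Set.Ioo D.lo D.hi)) :
    StrictMonoOn (D.payProb N) (Set.Icc D.lo D.hi) := by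
  intro x hx y hy hxy
  rcases hx.1.eq_or_lt with rfl | hlo
  · rw [D.payProb_lo hN]; exact D.payProb_pos hN hxy
  have hF := D.F_strictMonoOn hx hy hxy
  have hthr : D.F (D.payThreshold x) ^ (N - 2) ≤ D.F (D.payThreshold y) ^ (N - 2) :=
    pow_le_pow_left₀ (D.F_nonneg _)
      (D.F_mono (payThreshold_monotoneOn hψ ⟨hlo, hx.2⟩ ⟨hlo.trans hxy, hy.2⟩ hxy.le)) _
  have hthr' : D.F (D.payThreshold x) ^ (N - 2) ≤ D.F x ^ (N - 2) :=
    pow_le_pow_left₀ (D.F_nonneg _) (D.F_payThreshold_le x) _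
  have hN' := natCast_sub_one_pos hN
  have hbernoulli : D.F x ^ (N - 1) + ((N : ℝ) - 1) * D.F x ^ (N - 2) * (D.F y - D.F x) <
      D.F y ^ (N - 1) := by
    simpa only [Nat.cast_sub (by omega : 1 ≤ N), Nat.cast_one, Nat.sub_sub]
      using pow_add_mul_lt_pow (D.F_nonneg x) hF (n := N - 1) (by omega)
  calc D.payProb N x
      = D.F x ^ (N - 1) + ((N : ℝ) - 1) * D.F (D.payThreshold x) ^ (N - 2) * (D.F y - D.F x)
          + ((N : ℝ) - 1) * D.F (D.payThreshold x) ^ (N - 2) * (1 - D.F y) := by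
        unfold payProb; ring
    _ ≤ D.F x ^ (N - 1) + ((N : ℝ) - 1) * D.F x ^ (N - 2) * (D.F y - D.F x)
          + ((N : ℝ) - 1) * D.F (D.payThreshold y) ^ (N - 2) * (1 - D.F y) := by
        have := sub_nonneg.mpr hF.le
        have := sub_nonneg.mpr (D.F_le_one y)
        gcongr
    _ < D.payProb N y := add_lt_add_left hbernoulli _

lemma continuousAt_payProb_of_G₁_eq_G₂ {x : ℝ} (hx : D.G₁ N x = D.G₂ N x) :
    ContinuousAt (D.payProb N) x := by
  have hF := D.continuous_F
  have hG₁ : Continuous (D.G₁ N) := hF.pow _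
  have hG₂ : Continuous (D.G₂ N) := by unfold G₂; fun_prop
  have hpay : D.payProb N x = D.G₁ N x :=
    le_antisymm (hx ▸ D.payProb_le_G₂ hN x) (D.G₁_le_payProb hN x)
  rw [ContinuousAt, hpay]
  exact tendsto_of_tendsto_of_tendsto_of_le_of_le hG₁.continuousAt
    (hx ▸ hG₂.continuousAt : Filter.Tendsto (D.G₂ N) (nhds x) (nhds (D.G₁ N x)))
    (D.G₁_le_payProb hN) (D.payProb_le_G₂ hN)

lemma continuousOn_payProb : ContinuousOn (D.payProb N) (Set.Icc D.lo D.hi) := by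
  intro x hx
  refine ContinuousAt.continuousWithinAt ?_
  rcases hx.1.eq_or_lt with rfl | hlo
  · exact D.continuousAt_payProb_of_G₁_eq_G₂ hN (by rw [D.G₁_lo hN, D.G₂_lo hN])
  rcases hx.2.eq_or_lt with rfl | hhi
  · exact D.continuousAt_payProb_of_G₁_eq_G₂ hN (by simp only [G₁, G₂, F_hi, sub_self, mul_zero,
      add_zero])
  have hF := D.continuous_F
  have hthr : ContinuousAt D.payThreshold x :=
    continuousAt_id.min (continuousAt_id.add (D.continuousAt_psi ⟨hlo, hhi⟩))
  have hFthr : ContinuousAt (fun q => D.F (D.payThreshold q)) x := hF.continuousAt.comp hthr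
  exact (hF.continuousAt.pow _).add ((continuousAt_const.mul (hFthr.pow _)).mul
    (continuousAt_const.sub hF.continuousAt))

end PayProb

section Thresholds

lemma psi_hi_nonneg : 0 ≤ D.psi D.hi := by rw [psi_hi]; exact D.lo_nonneg.trans D.lo_lt_hi.le

lemma psiInvZero_set_nonempty : {t : ℝ | t ∈ Set.Ioc D.lo D.hi ∧ 0 ≤ D.psi t}.Nonempty :=
  ⟨D.hi, ⟨D.lo_lt_hi, le_rfl⟩, D.psi_hi_nonneg⟩

lemma psiInvZero_le {t : ℝ} (ht : t ∈ Set.Ioc D.lo D.hi) (h : 0 ≤ D.psi t) : D.psiInvZero ≤ t :=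
  csInf_le ⟨D.lo, fun _ h => h.1.1.le⟩ ⟨ht, h⟩

lemma psiInvZero_le_hi : D.psiInvZero ≤ D.hi :=
  D.psiInvZero_le ⟨D.lo_lt_hi, le_rfl⟩ D.psi_hi_nonneg

lemma a_zero_le {t : ℝ} (ht : t ∈ Set.Ioc D.lo D.hi) (h : 0 ≤ t + D.psi t) : D.a 0 ≤ t :=
  csInf_le ⟨D.lo, fun _ h => h.1.1.le⟩ ⟨ht, D.lo_nonneg.trans ht.1.le, h⟩

lemma lo_le_a_zero : D.lo ≤ D.a 0 :=
  have hhi : 0 ≤ D.hi := D.lo_nonneg.trans D.lo_lt_hi.le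
  le_csInf ⟨D.hi, ⟨D.lo_lt_hi, le_rfl⟩, hhi, add_nonneg hhi D.psi_hi_nonneg⟩ fun _ h => h.1.1.le

lemma a_zero_le_psiInvZero : D.a 0 ≤ D.psiInvZero :=
  le_csInf D.psiInvZero_set_nonempty fun _ ht =>
    D.a_zero_le ht.1 (add_nonneg (D.lo_nonneg.trans ht.1.1.le) ht.2)

lemma psi_neg_of_lt {x : ℝ} (hlo : D.lo < x) (hx : x < D.psiInvZero) : D.psi x < 0 :=
  lt_of_not_ge fun h => hx.not_ge (D.psiInvZero_le ⟨hlo, hx.le.trans D.psiInvZero_le_hi⟩ h)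

lemma add_psi_neg_of_lt {x : ℝ} (hlo : D.lo < x) (hx : x < D.a 0) : x + D.psi x < 0 :=
  lt_of_not_ge fun h => hx.not_ge
    (D.a_zero_le ⟨hlo, hx.le.trans (D.a_zero_le_psiInvZero.trans D.psiInvZero_le_hi)⟩ h)

lemma add_psi_nonpos_of_le {x : ℝ} (hx : x ∈ Set.Ioo D.lo D.hi) (hxa : x ≤ D.a 0) :
    x + D.psi x ≤ 0 := by
  have hcont := continuousAt_id.add (D.continuousAt_psi hx)
  refine le_of_tendsto (hcont.tendsto.mono_left (nhdsWithin_le_nhds (s := Set.Iio x))) ?_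
  filter_upwards [Ioo_mem_nhdsLT hx.1] with y hy
  exact (D.add_psi_neg_of_lt hy.1 (hy.2.trans_le hxa)).le

variable {D}

lemma psi_nonneg_of_gt (hψ : MonotoneOn D.psi (Set.Ioo D.lo D.hi)) {x : ℝ}
    (hx : x ∈ Set.Ioc D.lo D.hi) (h : D.psiInvZero < x) : 0 ≤ D.psi x := by
  obtain ⟨t, ht, htx⟩ := exists_lt_of_csInf_lt D.psiInvZero_set_nonempty h
  exact ht.2.trans (psi_monotoneOn_Ioc hψ ht.1 hx htx.le)

lemma psi_nonneg_of_ge (hψ : MonotoneOn D.psi (Set.Ioo D.lo D.hi)) {x : ℝ}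
    (hx : x ∈ Set.Ioc D.lo D.hi) (h : D.psiInvZero ≤ x) : 0 ≤ D.psi x := by
  rcases hx.2.eq_or_lt with rfl | hhi
  · exact D.psi_hi_nonneg
  have hcont := D.continuousAt_psi ⟨hx.1, hhi⟩
  refine ge_of_tendsto (hcont.tendsto.mono_left (nhdsWithin_le_nhds (s := Set.Ioi x))) ?_
  filter_upwards [Ioo_mem_nhdsGT hhi] with y hy
  exact psi_nonneg_of_gt hψ ⟨hx.1.trans hy.1, hy.2.le⟩ (h.trans_lt hy.1)

end Thresholds

end ValueDistribution

section IntegrationByParts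

lemma intervalIntegrable_of_monotoneOn_of_hasDerivAt_off_singleton {P p : ℝ → ℝ} {a b c : ℝ}
    (hab : a ≤ b) (hP : ContinuousOn P (Set.Icc a b)) (hmono : MonotoneOn P (Set.Icc a b))
    (hderiv : ∀ s ∈ Set.Ioo a b, s ≠ c → HasDerivAt P (p s) s) :
    IntervalIntegrable p volume a b := by
  have off : ∀ u v, a ≤ u → u ≤ v → v ≤ b → c ∉ Set.Ioo u v →
      IntervalIntegrable p volume u v := by
    intro u v hu huv hv hc
    have hmem : ∀ s ∈ Set.Ioo u v, s ∈ Set.Ioo a b ∧ s ≠ c := fun s hs =>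
      ⟨⟨hu.trans_lt hs.1, hs.2.trans_le hv⟩, fun h => hc (h ▸ hs)⟩
    have hd : ∀ s ∈ Set.Ioo u v, HasDerivAt P (p s) s :=
      fun s hs => hderiv s (hmem s hs).1 (hmem s hs).2
    rw [intervalIntegrable_iff_integrableOn_Ioc_of_le huv]
    refine intervalIntegral.integrableOn_deriv_of_nonneg
      (hP.mono (Set.Icc_subset_Icc hu hv)) hd fun s hs => ?_
    have hsab := (hmem s hs).1
    exact (hd s hs).hasDerivWithinAt.nonneg_of_monotoneOn
      (uniqueDiffOn_Ioo a b s hsab).accPt (hmono.mono Set.Ioo_subset_Icc_self)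
  by_cases hc : c ∈ Set.Ioo a b
  · exact (off a c le_rfl hc.1.le hc.2.le Set.right_notMem_Ioo).trans
      (off c b hc.1.le hc.2.le le_rfl Set.left_notMem_Ioo)
  · exact off a b le_rfl hab le_rfl hc

lemma integral_id_mul_deriv_of_monotoneOn {P p : ℝ → ℝ} {a b c : ℝ} (hab : a ≤ b)
    (hP : ContinuousOn P (Set.Icc a b)) (hmono : MonotoneOn P (Set.Icc a b))
    (hderiv : ∀ s ∈ Set.Ioo a b, s ≠ c → HasDerivAt P (p s) s) :
    ∫ s in a..b, s * p s = b * P b - a * P a - ∫ s in a..b, P s := by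
  have hp := intervalIntegrable_of_monotoneOn_of_hasDerivAt_off_singleton hab hP hmono hderiv
  have hPint : IntervalIntegrable P volume a b := hP.intervalIntegrable_of_Icc hab
  have hidp : IntervalIntegrable (fun s => s * p s) volume a b :=
    hp.continuousOn_mul continuousOn_id
  have hparts : ∫ s in a..b, (P s + s * p s) = b * P b - a * P a :=
    integral_eq_of_hasDerivAt_off_countable_of_le (fun s => s * P s) _ hab
      (Set.countable_singleton c) (continuousOn_id.mul hP)
      (fun s hs => ((hasDerivAt_id' s).fun_mul (hderiv s hs.1 hs.2)).congr_deriv (by ring))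
      (hPint.add hidp)
  rw [← hparts, intervalIntegral.integral_add hPint hidp, add_sub_cancel_left]

end IntegrationByParts

namespace ValueDistribution

variable (D : ValueDistribution) {N : ℕ}

section Derivatives

variable (hN : 3 ≤ N)
include hN

lemma hasDerivAt_G₁ {s : ℝ} (hs : s ∈ Set.Ioo D.lo D.hi) :
    HasDerivAt (D.G₁ N) (D.g₁ N s) s := by
  refine ((D.hasDerivAt_F hs.1.ne' hs.2.ne).fun_pow (N - 1)).congr_deriv ?_
  rw [g₁, Nat.cast_sub (by omega : 1 ≤ N), Nat.cast_one, Nat.sub_sub]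

lemma hasDerivAt_G₂ {s : ℝ} (hs : s ∈ Set.Ioo D.lo D.hi) :
    HasDerivAt (D.G₂ N) (D.g₂ N s) s := by
  have hF := D.hasDerivAt_F hs.1.ne' hs.2.ne
  refine ((D.hasDerivAt_G₁ hN hs).fun_add
    (((hF.fun_pow (N - 2)).const_mul ((N : ℝ) - 1)).fun_mul (hF.const_sub 1))).congr_deriv ?_
  rw [g₁, g₂, Nat.cast_sub (by omega : 2 ≤ N), Nat.cast_two, Nat.sub_sub]
  ring

lemma payProb_eq_G₁_of_le {x : ℝ} (hl : D.lo ≤ x) (hx : x ≤ D.a 0) :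
    D.payProb N x = D.G₁ N x := by
  rcases hl.eq_or_lt with rfl | hl
  · rw [D.payProb_lo hN, D.G₁_lo hN]
  rcases (hx.trans (D.a_zero_le_psiInvZero.trans D.psiInvZero_le_hi)).eq_or_lt with rfl | hhi
  · rw [payProb, G₁, F_hi, sub_self, mul_zero, add_zero]
  · exact D.payProb_of_add_psi_le_lo hN ((D.add_psi_nonpos_of_le ⟨hl, hhi⟩ hx).trans D.lo_nonneg)

lemma hasDerivAt_payProb_of_lt_a_zero {s : ℝ} (hs : s ∈ Set.Ioo D.lo (D.a 0)) :
    HasDerivAt (D.payProb N) (D.g₁ N s) s := by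
  have hhi := hs.2.trans_le (D.a_zero_le_psiInvZero.trans D.psiInvZero_le_hi)
  refine (D.hasDerivAt_G₁ hN ⟨hs.1, hhi⟩).congr_of_eventuallyEq ?_
  filter_upwards [Ioo_mem_nhds hs.1 hs.2] with u hu
  exact D.payProb_eq_G₁_of_le hN hu.1.le hu.2.le

lemma hasDerivAt_payProb_of_mem_Ioo
    (hdiff : DifferentiableOn ℝ D.psi (Set.Ioo (D.a 0) D.psiInvZero)) {s : ℝ}
    (hs : s ∈ Set.Ioo (D.a 0) D.psiInvZero) (hne : s + D.psi s ≠ D.lo) :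
    HasDerivAt (D.payProb N) (D.H' N s) s := by
  have hs' : s ∈ Set.Ioo D.lo D.hi :=
    ⟨D.lo_le_a_zero.trans_lt hs.1, hs.2.trans_le D.psiInvZero_le_hi⟩
  have hψs := (hdiff.differentiableAt (Ioo_mem_nhds hs.1 hs.2)).hasDerivAt
  have hF := D.hasDerivAt_F hs'.1.ne' hs'.2.ne
  have hFψ : HasDerivAt (fun u => D.F (u + D.psi u))
      (D.f (s + D.psi s) * (1 + deriv D.psi s)) s :=
    (D.hasDerivAt_F hne (by linarith [hs'.2, D.psi_neg_of_lt hs'.1 hs.2])).comp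
      (h₂ := D.F) s ((hasDerivAt_id' s).fun_add hψs)
  have hmid : HasDerivAt
      (fun u => D.G₁ N u + ((N : ℝ) - 1) * D.F (u + D.psi u) ^ (N - 2) * (1 - D.F u))
      (D.H' N s) s := by
    refine ((D.hasDerivAt_G₁ hN hs').fun_add
      (((hFψ.fun_pow (N - 2)).const_mul ((N : ℝ) - 1)).fun_mul (hF.const_sub 1))).congr_deriv ?_
    rw [H', Nat.cast_sub (by omega : 2 ≤ N), Nat.cast_two, Nat.sub_sub]
    ring
  refine hmid.congr_of_eventuallyEq ?_
  filter_upwards [Ioo_mem_nhds hs.1 hs.2] with u hu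
  exact D.payProb_of_psi_nonpos (D.psi_neg_of_lt (D.lo_le_a_zero.trans_lt hu.1) hu.2).le

lemma hasDerivAt_payProb_of_psiInvZero_lt (hψ : MonotoneOn D.psi (Set.Ioo D.lo D.hi)) {s : ℝ}
    (hs : s ∈ Set.Ioo D.psiInvZero D.hi) : HasDerivAt (D.payProb N) (D.g₂ N s) s := by
  have hlo := D.lo_le_a_zero.trans D.a_zero_le_psiInvZero
  refine (D.hasDerivAt_G₂ hN ⟨hlo.trans_lt hs.1, hs.2⟩).congr_of_eventuallyEq ?_
  filter_upwards [Ioo_mem_nhds hs.1 hs.2] with u hu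
  exact D.payProb_of_psi_nonneg (psi_nonneg_of_gt hψ ⟨hlo.trans_lt hu.1, hu.2.le⟩ hu.1)

end Derivatives

section BidFormula

lemma exists_forall_ne_add_psi_ne_lo (hψ : MonotoneOn D.psi (Set.Ioo D.lo D.hi)) :
    ∃ c, ∀ s ∈ Set.Ioo D.lo D.hi, s ≠ c → s + D.psi s ≠ D.lo := by
  by_cases h : ∃ c ∈ Set.Ioo D.lo D.hi, c + D.psi c = D.lo
  · obtain ⟨c, hc, hcψ⟩ := h
    have hmono : StrictMonoOn (fun s => s + D.psi s) (Set.Ioo D.lo D.hi) :=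
      strictMonoOn_id.add_monotone hψ
    exact ⟨c, fun s hs hsc hsψ => hsc (hmono.injOn hs hc (hsψ.trans hcψ.symm))⟩
  · exact ⟨0, fun s hs _ hsψ => h ⟨s, hs, hsψ⟩⟩

variable (hN : 3 ≤ N) (hψ : MonotoneOn D.psi (Set.Ioo D.lo D.hi))
include hN hψ

lemma H_eq_payProb {x : ℝ} (hx : x ∈ Set.Ioc D.lo D.hi) : D.H N x = D.payProb N x := by
  unfold H
  split_ifs with hhigh hmid
  · exact (D.payProb_of_psi_nonneg (psi_nonneg_of_ge hψ hx hhigh)).symm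
  · exact (D.payProb_of_psi_nonpos (D.psi_neg_of_lt hx.1 (not_le.mp hhigh)).le).symm
  · exact (D.payProb_eq_G₁_of_le hN hx.1.le (not_le.mp hmid).le).symm

lemma integral_id_mul_deriv_payProb {a b c : ℝ} {p : ℝ → ℝ} (ha : D.lo ≤ a) (hab : a ≤ b)
    (hb : b ≤ D.hi) (hderiv : ∀ s ∈ Set.Ioo a b, s ≠ c → HasDerivAt (D.payProb N) (p s) s) :
    a * D.payProb N a - (∫ s in D.lo..a, D.payProb N s) + ∫ s in a..b, s * p s =
      b * D.payProb N b - ∫ s in D.lo..b, D.payProb N s := by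
  have hcont := D.continuousOn_payProb hN
  have hcab := hcont.mono (Set.Icc_subset_Icc ha hb)
  rw [integral_id_mul_deriv_of_monotoneOn hab hcab
      ((D.payProb_strictMonoOn hN hψ).monotoneOn.mono (Set.Icc_subset_Icc ha hb)) hderiv,
    ← intervalIntegral.integral_add_adjacent_intervals
      ((hcont.mono (Set.Icc_subset_Icc le_rfl (hab.trans hb))).intervalIntegrable_of_Icc ha)
      (hcab.intervalIntegrable_of_Icc hab)]
  ring

lemma payProb_mul_bidLow {x : ℝ} (hl : D.lo ≤ x) (hx : x ≤ D.a 0) :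
    D.payProb N x * D.bidLow N x = x * D.payProb N x - ∫ s in D.lo..x, D.payProb N s := by
  rcases hl.eq_or_lt with rfl | hl
  · rw [D.payProb_lo hN, zero_mul, mul_zero, intervalIntegral.integral_same, sub_zero]
  rw [← D.integral_id_mul_deriv_payProb hN hψ (c := D.lo) le_rfl hl.le
      (hx.trans (D.a_zero_le_psiInvZero.trans D.psiInvZero_le_hi))
      fun s hs _ => D.hasDerivAt_payProb_of_lt_a_zero hN ⟨hs.1, hs.2.trans_le hx⟩,
    bidLow, ← D.payProb_eq_G₁_of_le hN hl.le hx, ← mul_assoc,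
    mul_one_div_cancel (D.payProb_pos hN hl).ne', one_mul, D.payProb_lo hN, mul_zero,
    intervalIntegral.integral_same, sub_zero, zero_add]

variable (hdiff : DifferentiableOn ℝ D.psi (Set.Ioo (D.a 0) D.psiInvZero))
include hdiff

lemma payProb_mul_bidMid {x : ℝ} (hl : D.a 0 ≤ x) (hx : x ≤ D.psiInvZero) :
    D.payProb N x * D.bidMid N x = x * D.payProb N x - ∫ s in D.lo..x, D.payProb N s := by
  have ha := D.lo_le_a_zero
  have hxhi := hx.trans D.psiInvZero_le_hi
  rcases (ha.trans hl).eq_or_lt with rfl | hlo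
  · rw [D.payProb_lo hN, zero_mul, mul_zero, intervalIntegral.integral_same, sub_zero]
  obtain ⟨c, hc⟩ := D.exists_forall_ne_add_psi_ne_lo hψ
  rw [← D.integral_id_mul_deriv_payProb hN hψ (c := c) ha hl hxhi fun s hs hsc =>
      D.hasDerivAt_payProb_of_mem_Ioo hN hdiff ⟨hs.1, hs.2.trans_le hx⟩
        (hc s ⟨ha.trans_lt hs.1, hs.2.trans_le hxhi⟩ hsc),
    ← D.payProb_mul_bidLow hN hψ ha le_rfl, bidMid, D.H_eq_payProb hN hψ ⟨hlo, hxhi⟩,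
    ← D.payProb_eq_G₁_of_le hN ha le_rfl, ← mul_assoc,
    mul_one_div_cancel (D.payProb_pos hN hlo).ne', one_mul]

lemma payProb_mul_bidHigh {x : ℝ} (hl : D.psiInvZero ≤ x) (hx : x ≤ D.hi) :
    D.payProb N x * D.bidHigh N x = x * D.payProb N x - ∫ s in D.lo..x, D.payProb N s := by
  have hz := D.lo_le_a_zero.trans D.a_zero_le_psiInvZero
  rcases (hz.trans hl).eq_or_lt with rfl | hlo
  · rw [D.payProb_lo hN, zero_mul, mul_zero, intervalIntegral.integral_same, sub_zero]
  have hG₂ : D.payProb N D.psiInvZero = D.G₂ N D.psiInvZero := by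
    rcases hz.eq_or_lt with hz | hz
    · rw [← hz, D.payProb_lo hN, D.G₂_lo hN]
    · exact D.payProb_of_psi_nonneg (psi_nonneg_of_ge hψ ⟨hz, D.psiInvZero_le_hi⟩ le_rfl)
  rw [← D.integral_id_mul_deriv_payProb hN hψ (c := D.lo) hz hl hx fun s hs _ =>
      D.hasDerivAt_payProb_of_psiInvZero_lt hN hψ ⟨hs.1, hs.2.trans_le hx⟩,
    ← D.payProb_mul_bidMid hN hψ hdiff D.a_zero_le_psiInvZero le_rfl, bidHigh, ← hG₂,
    ← D.payProb_of_psi_nonneg (psi_nonneg_of_ge hψ ⟨hlo, hx⟩ hl), ← mul_assoc,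
    mul_one_div_cancel (D.payProb_pos hN hlo).ne', one_mul]

lemma payProb_mul_sub_bid {x : ℝ} (hx : x ∈ Set.Icc D.lo D.hi) :
    D.payProb N x * (x - D.bid N x) = ∫ s in D.lo..x, D.payProb N s := by
  suffices D.payProb N x * D.bid N x = x * D.payProb N x - ∫ s in D.lo..x, D.payProb N s by
    rw [mul_sub, this]; ring
  unfold bid
  split_ifs with hhigh hmid
  · exact D.payProb_mul_bidHigh hN hψ hdiff hhigh hx.2
  · exact D.payProb_mul_bidMid hN hψ hdiff hmid (not_le.mp hhigh).le
  · exact D.payProb_mul_bidLow hN hψ hx.1 (not_le.mp hmid).le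

omit hψ hdiff in
lemma bid_lo : D.bid N D.lo = 0 := by
  unfold bid
  split_ifs with hhigh hmid
  · rw [bidHigh, D.G₂_lo hN, div_zero, zero_mul]
  · have ha : D.a 0 = D.lo := le_antisymm hmid D.lo_le_a_zero
    rw [bidMid, ha, D.G₁_lo hN, intervalIntegral.integral_same, zero_mul, add_zero, mul_zero]
  · rw [bidLow, D.G₁_lo hN, div_zero, zero_mul]

lemma bid_le_self {x : ℝ} (hx : x ∈ Set.Icc D.lo D.hi) : D.bid N x ≤ x := by
  rcases hx.1.eq_or_lt with rfl | hl
  · rw [D.bid_lo hN]; exact D.lo_nonneg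
  refine sub_nonneg.mp (nonneg_of_mul_nonneg_right ?_ (D.payProb_pos hN hl))
  rw [D.payProb_mul_sub_bid hN hψ hdiff hx]
  exact intervalIntegral.integral_nonneg hx.1 fun s _ => D.payProb_nonneg hN s

lemma bid_strictMonoOn : StrictMonoOn (D.bid N) (Set.Icc D.lo D.hi) := by
  intro x hx y hy hxy
  have hP := D.payProb_strictMonoOn hN hψ
  have hcont := D.continuousOn_payProb hN
  have hcxy : ContinuousOn (D.payProb N) (Set.Icc x y) := hcont.mono (Set.Icc_subset_Icc hx.1 hy.2)
  have hincr : ∫ s in x..y, D.payProb N s < (y - x) * D.payProb N y := by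
    rw [← smul_eq_mul, ← intervalIntegral.integral_const]
    exact intervalIntegral.integral_lt_integral_of_continuousOn_of_le_of_exists_lt hxy hcxy
      continuousOn_const
      (fun s hs => hP.monotoneOn ⟨hx.1.trans hs.1.le, hs.2.trans hy.2⟩ hy hs.2)
      ⟨x, ⟨le_rfl, hxy.le⟩, hP hx hy hxy⟩
  have hsurplus : D.payProb N y * (y - D.bid N y) <
      D.payProb N y * (x - D.bid N x) + (y - x) * D.payProb N y :=
    calc D.payProb N y * (y - D.bid N y)
        = D.payProb N x * (x - D.bid N x) + ∫ s in x..y, D.payProb N s := by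
          rw [D.payProb_mul_sub_bid hN hψ hdiff hx, D.payProb_mul_sub_bid hN hψ hdiff hy,
            intervalIntegral.integral_add_adjacent_intervals
              ((hcont.mono (Set.Icc_subset_Icc le_rfl hx.2)).intervalIntegrable_of_Icc hx.1)
              (hcxy.intervalIntegrable_of_Icc hxy.le)]
      _ < D.payProb N y * (x - D.bid N x) + (y - x) * D.payProb N y :=
          add_lt_add_of_le_of_lt (mul_le_mul_of_nonneg_right (hP hx hy hxy).le
            (sub_nonneg.mpr (D.bid_le_self hN hψ hdiff hx))) hincr
  refine lt_of_mul_lt_mul_left ?_ (D.payProb_nonneg hN y)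
  linarith

lemma bid_nonneg {x : ℝ} (hx : x ∈ Set.Icc D.lo D.hi) : 0 ≤ D.bid N x := by
  rw [← D.bid_lo hN]
  exact (D.bid_strictMonoOn hN hψ hdiff).monotoneOn D.lo_mem_Icc hx hx.1

lemma bid_le_of_forall_lt {q b : ℝ} (hq : q ∈ Set.Ioc D.lo D.hi)
    (h : ∀ z ∈ Set.Ioo D.lo q, D.bid N z ≤ b) : D.bid N q ≤ b := by
  have hcont := D.continuousOn_payProb hN
  have hqm : q ∈ Set.Icc D.lo D.hi := ⟨hq.1.le, hq.2⟩
  have hsub : Set.Ioo D.lo q ⊆ Set.Icc D.lo D.hi := fun z hz => ⟨hz.1.le, hz.2.le.trans hq.2⟩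
  have hprim : ContinuousOn (fun z => ∫ s in D.lo..z, D.payProb N s) (Set.Icc D.lo D.hi) := by
    simpa only [Set.uIcc_of_le D.lo_lt_hi.le] using
      intervalIntegral.continuousOn_primitive_interval (a := D.lo) (b := D.hi) (μ := volume)
        (by rw [Set.uIcc_of_le D.lo_lt_hi.le]; exact hcont.integrableOn_Icc)
  have hmul : ∀ z ∈ Set.Icc D.lo D.hi, z * D.payProb N z - ∫ s in D.lo..z, D.payProb N s =
      D.bid N z * D.payProb N z := fun z hz => by
    rw [← D.payProb_mul_sub_bid hN hψ hdiff hz]; ring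
  refine le_of_mul_le_mul_right ?_ (D.payProb_pos hN hq.1)
  rw [← hmul q hqm]
  refine ContinuousWithinAt.closure_le (s := Set.Ioo D.lo q)
    (by rw [closure_Ioo hq.1.ne]; exact ⟨hq.1.le, le_rfl⟩)
    (((continuousOn_id.mul hcont).sub hprim q hqm).mono hsub)
    (((continuousOn_const.mul hcont) q hqm).mono hsub) fun z hz => ?_
  exact (hmul z (hsub hz)).trans_le
    (mul_le_mul_of_nonneg_right (h z hz) (D.payProb_nonneg hN z))

end BidFormula

end ValueDistribution

/-! ### The revenue bound -/

section SecondAuction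

variable {N : ℕ} {s : Finset (Fin N)} {x y : Fin N → ℝ} {i : Fin N}

lemma card_univ_erase (i : Fin N) : (Finset.univ.erase i).card = N - 1 := by
  rw [Finset.card_erase_of_mem (Finset.mem_univ i), Finset.card_univ, Fintype.card_fin]

lemma one_le_card_univ_erase (hN : 3 ≤ N) (i : Fin N) : 1 ≤ (Finset.univ.erase i).card := by
  rw [card_univ_erase]; omega

lemma one_le_card_univ_erase_erase (hN : 3 ≤ N) (k i : Fin N) :
    1 ≤ ((Finset.univ.erase k).erase i).card := by
  have h := Finset.pred_card_le_card_erase (s := Finset.univ.erase k) (a := i)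
  rw [card_univ_erase] at h
  omega

/-- Indicator of the event that buyer `i` outbids all rivals in a second-price auction among the
buyers in `s` who bid their values. Ties count as losses; they leave no surplus to the winner. -/
noncomputable def secondAuctionWin (s : Finset (Fin N)) (x : Fin N → ℝ) (i : Fin N) : ℝ :=
  if kthHighest (s.erase i) x 1 < x i then 1 else 0

lemma secondAuctionWin_mem_Icc : secondAuctionWin s x i ∈ Set.Icc 0 1 := by
  unfold secondAuctionWin
  split_ifs <;> simp

lemma secondAuctionSurplus_nonneg : 0 ≤ secondAuctionSurplus s x i := le_max_right _ _

lemma secondAuctionSurplus_eq_win_mul :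
    secondAuctionSurplus s x i = secondAuctionWin s x i * (x i - kthHighest (s.erase i) x 1) := by
  unfold secondAuctionSurplus secondAuctionWin
  split_ifs with h
  · rw [one_mul, max_eq_left (by linarith)]
  · rw [zero_mul, max_eq_right (by linarith)]

lemma secondAuctionSurplus_le (hs : 1 ≤ (s.erase i).card) (hx : ∀ j, 0 ≤ x j) :
    secondAuctionSurplus s x i ≤ x i := by
  have : 0 ≤ kthHighest (s.erase i) x 1 := kthHighest_mem (A := Set.Ici 0) le_rfl hs fun j _ => hx j
  exact max_le (by linarith) (hx i)

lemma secondAuctionSurplus_update (z : ℝ) : secondAuctionSurplus s (Function.update y i z) i =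
    max (z - kthHighest (s.erase i) y 1) 0 := by
  rw [secondAuctionSurplus, kthHighest_erase_update, Function.update_self]

lemma secondAuctionWin_update (z : ℝ) : secondAuctionWin s (Function.update y i z) i =
    if kthHighest (s.erase i) y 1 < z then 1 else 0 := by
  rw [secondAuctionWin, kthHighest_erase_update, Function.update_self]

lemma isSubgradientOn_secondAuctionSurplus (s : Finset (Fin N)) (y : Fin N → ℝ) (i : Fin N) :
    IsSubgradientOn (fun x => secondAuctionWin s (Function.update y i x) i)
      (fun x => secondAuctionSurplus s (Function.update y i x) i) Set.univ := by
  intro x _ z _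
  simp only [secondAuctionWin_update, secondAuctionSurplus_update]
  split_ifs with h
  · rw [max_eq_left (by linarith)]
    exact le_max_of_le_left (by linarith)
  · rw [max_eq_right (by linarith), mul_zero, add_zero]
    exact le_max_right _ _

lemma measurable_secondAuctionWin (hs : 1 ≤ (s.erase i).card) :
    Measurable fun x => secondAuctionWin s x i :=
  Measurable.ite (measurableSet_lt (measurable_kthHighest le_rfl hs) (measurable_pi_apply i))
    measurable_const measurable_const

lemma measurable_secondAuctionSurplus (hs : 1 ≤ (s.erase i).card) :
    Measurable fun x => secondAuctionSurplus s x i :=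
  ((measurable_pi_apply i).sub (measurable_kthHighest le_rfl hs)).max measurable_const

end SecondAuction

namespace ValueDistribution

variable (D : ValueDistribution) {N : ℕ}

/-- The virtual surplus generated by a second-price auction among the buyers in `s`: the virtual
valuation of the winner less the price, which the first seller does not receive. -/
noncomputable def secondAuctionVirtualSurplus (s : Finset (Fin N)) (x : Fin N → ℝ) : ℝ :=
  D.psi (kthHighest s x 1) - kthHighest s x 2

lemma sum_secondAuctionSurplus_sub_win_mul {s : Finset (Fin N)} {x : Fin N → ℝ} (hs : 2 ≤ s.card)
    (hx : Set.InjOn x s) :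
    ∑ i ∈ s, (secondAuctionSurplus s x i - secondAuctionWin s x i * (x i - D.psi (x i))) =
      D.secondAuctionVirtualSurplus s x := by
  obtain ⟨a, b, h⟩ := exists_isTopTwo hs hx
  simp only [secondAuctionSurplus_eq_win_mul, secondAuctionWin]
  rw [Finset.sum_eq_single_of_mem a h.left_mem fun i hi hia => ?_, secondAuctionVirtualSurplus,
    h.kthHighest_one, h.kthHighest_two, h.kthHighest_erase_left_one, if_pos h.lt]
  · ring
  · rw [h.kthHighest_erase_one_of_ne hia, if_neg (h.le_left hi).not_gt]
    ring

lemma sub_psi_mul_f {z : ℝ} (hz : z ∈ Set.Ioo D.lo D.hi) : (z - D.psi z) * D.f z = 1 - D.F z := by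
  rw [psi, sub_sub_cancel, div_mul_cancel₀ _ (D.f_pos z hz).ne']

lemma integrable_sub_psi : Integrable (fun z => z - D.psi z) D.law := by
  have hsupp : Function.support (fun z => (z - D.psi z) * D.f z) ⊆ Set.Icc D.lo D.hi :=
    Function.support_subset_iff'.mpr fun z hz => by rw [D.f_eq_zero z hz, mul_zero]
  rw [integrable_law_iff, ← integrableOn_iff_integrable_of_support_subset hsupp,
    integrableOn_Icc_iff_integrableOn_Ioo]
  exact ((continuous_const.sub D.continuous_F).continuousOn.integrableOn_Icc.mono_set
    Set.Ioo_subset_Icc_self).congr_fun (fun z hz => (D.sub_psi_mul_f hz).symm) measurableSet_Ioo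

/-- Integration by parts against `1 - F`: the information rents `w` of all lower types are charged
to a type through its virtual valuation. -/
lemma integral_law_of_isSubgradientOn {w V : ℝ → ℝ}
    (h : IsSubgradientOn w V (Set.Icc D.lo D.hi)) :
    ∫ z, V z ∂D.law = V D.lo + ∫ z, w z * (z - D.psi z) ∂D.law := by
  have hV : IntervalIntegrable (fun z => V z * D.f z) volume D.lo D.hi :=
    (h.continuousOn_Icc.mul D.continuousOn_f).intervalIntegrable_of_Icc D.lo_lt_hi.le
  have hw : IntervalIntegrable (fun z => w z * (1 - D.F z)) volume D.lo D.hi :=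
    (Set.uIcc_of_le D.lo_lt_hi.le ▸ h.monotoneOn).intervalIntegrable.mul_continuousOn
      (continuous_const.sub D.continuous_F).continuousOn
  have hparts : ∫ z in D.lo..D.hi, (w z * (1 - D.F z) - V z * D.f z) =
      V D.hi * (1 - D.F D.hi) - V D.lo * (1 - D.F D.lo) := by
    refine integral_eq_of_hasDerivAt_off_countable_of_le (fun z => V z * (1 - D.F z)) _
      D.lo_lt_hi.le h.monotoneOn.countable_not_continuousWithinAt
      (h.continuousOn_Icc.mul (continuous_const.sub D.continuous_F).continuousOn) ?_ (hw.sub hV)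
    rintro z ⟨hz, hcont⟩
    have hnhds : Set.Icc D.lo D.hi ∈ nhds z := Icc_mem_nhds hz.1 hz.2
    have hwz : ContinuousAt w z := by
      by_contra hne
      exact hcont ⟨Set.Ioo_subset_Icc_self hz, fun hc => hne (hc.continuousAt hnhds)⟩
    exact ((h.hasDerivAt hnhds hwz).mul
      ((D.hasDerivAt_F hz.1.ne' hz.2.ne).const_sub 1)).congr_deriv (by ring)
  have hcongr : ∫ z in D.lo..D.hi, w z * (z - D.psi z) * D.f z =
      ∫ z in D.lo..D.hi, w z * (1 - D.F z) :=
    intervalIntegral.integral_congr_Ioo_of_le D.lo_lt_hi.le fun z hz => by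
      rw [mul_assoc, D.sub_psi_mul_f hz]
  rw [intervalIntegral.integral_sub hw hV, D.F_hi, D.F_lo] at hparts
  rw [integral_law, integral_law, hcongr]
  linarith

end ValueDistribution

namespace ValueDistribution

variable {D : ValueDistribution} {N : ℕ}

lemma ae_forall_update_mem_Icc (i : Fin N) {q : ℝ} (hq : q ∈ Set.Icc D.lo D.hi) :
    ∀ᵐ y ∂D.jointLaw N, ∀ j, Function.update y i q j ∈ Set.Icc D.lo D.hi := by
  filter_upwards [D.ae_forall_mem_Icc] with y hy j
  rcases eq_or_ne j i with rfl | h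
  · simpa using hq
  · simpa [h] using hy j

lemma measurable_update_update (i : Fin N) (q x : ℝ) :
    Measurable fun y : Fin N → ℝ => (Function.update y i q, Function.update y i x) :=
  .prodMk (measurable_update'.comp (measurable_id.prodMk measurable_const))
    (measurable_update'.comp (measurable_id.prodMk measurable_const))

namespace DirectMechanism

variable (M : D.DirectMechanism N)

section AllocationMean

variable {q : Fin N → ℝ} {i : Fin N}

/-- The mean, over the allocation of the first good under the reports `q`, of a quantity concerning
buyer `i`: it is `own` if he gets the good, `rival k` if another buyer `k` does and `none` if the
good is withheld. -/
noncomputable def allocationMean (q : Fin N → ℝ) (i : Fin N) (own : ℝ) (rival : Fin N → ℝ)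
    (none : ℝ) : ℝ :=
  M.P q i * own + ∑ k ∈ Finset.univ.erase i, M.P q k * rival k + (1 - ∑ k, M.P q k) * none

lemma allocationMean_mono (hq : ∀ j, q j ∈ Set.Icc D.lo D.hi) {A A' C C' : ℝ} {B B' : Fin N → ℝ}
    (hA : A ≤ A') (hB : ∀ k, B k ≤ B' k) (hC : C ≤ C') :
    M.allocationMean q i A B C ≤ M.allocationMean q i A' B' C' :=
  add_le_add (add_le_add (mul_le_mul_of_nonneg_left hA (M.P_nonneg q hq i))
    (Finset.sum_le_sum fun k _ => mul_le_mul_of_nonneg_left (hB k) (M.P_nonneg q hq k)))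
    (mul_le_mul_of_nonneg_left hC (sub_nonneg.mpr (M.sum_P_le_one q hq)))

lemma allocationMean_const (q : Fin N → ℝ) (i : Fin N) (c : ℝ) :
    M.allocationMean q i c (fun _ => c) c = c := by
  rw [allocationMean, Finset.add_sum_erase _ (fun k => M.P q k * c) (Finset.mem_univ i),
    ← Finset.sum_mul]
  ring

lemma allocationMean_mem_Icc (hq : ∀ j, q j ∈ Set.Icc D.lo D.hi) {l u A C : ℝ} {B : Fin N → ℝ}
    (hA : A ∈ Set.Icc l u) (hB : ∀ k, B k ∈ Set.Icc l u) (hC : C ∈ Set.Icc l u) :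
    M.allocationMean q i A B C ∈ Set.Icc l u :=
  ⟨(M.allocationMean_const q i l).ge.trans
      (M.allocationMean_mono hq hA.1 (fun k => (hB k).1) hC.1),
    (M.allocationMean_mono hq hA.2 (fun k => (hB k).2) hC.2).trans
      (M.allocationMean_const q i u).le⟩

lemma allocationMean_add_mul (q : Fin N → ℝ) (i : Fin N) (A A' C C' c : ℝ) (B B' : Fin N → ℝ) :
    M.allocationMean q i (A + c * A') (fun k => B k + c * B' k) (C + c * C') =
      M.allocationMean q i A B C + c * M.allocationMean q i A' B' C' := by
  simp only [allocationMean, mul_add, Finset.sum_add_distrib, Finset.mul_sum, mul_left_comm c]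
  ring

lemma measurable_allocationMean (i : Fin N) {A C : (Fin N → ℝ) → ℝ} {B : Fin N → (Fin N → ℝ) → ℝ}
    (hA : Measurable A) (hB : ∀ k, Measurable (B k)) (hC : Measurable C) :
    Measurable fun p : (Fin N → ℝ) × (Fin N → ℝ) =>
      M.allocationMean p.1 i (A p.2) (fun k => B k p.2) (C p.2) := by
  have hP (k : Fin N) : Measurable fun p : (Fin N → ℝ) × (Fin N → ℝ) => M.P p.1 k :=
    (M.measurable_P k).comp measurable_fst
  exact (((hP i).mul (hA.comp measurable_snd)).add (Finset.measurable_sum _ fun k _ =>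
    (hP k).mul ((hB k).comp measurable_snd))).add
    ((measurable_const.sub (Finset.measurable_sum _ fun k _ => hP k)).mul (hC.comp measurable_snd))

lemma sum_allocationMean (q : Fin N → ℝ) (A C : Fin N → ℝ) (B : Fin N → Fin N → ℝ) :
    ∑ i, M.allocationMean q i (A i) (fun k => B k i) (C i) =
      ∑ k, M.P q k * (A k + ∑ i ∈ Finset.univ.erase k, B k i - ∑ i, C i) + ∑ i, C i := by
  have hcomm : ∑ i, ∑ k ∈ Finset.univ.erase i, M.P q k * B k i =
      ∑ k, M.P q k * ∑ i ∈ Finset.univ.erase k, B k i := by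
    simp only [Finset.mul_sum]
    exact Finset.sum_comm' fun i k => by simp [eq_comm]
  simp only [allocationMean, Finset.sum_add_distrib, hcomm, ← Finset.mul_sum, mul_sub, mul_add,
    Finset.sum_sub_distrib, ← Finset.sum_mul]
  ring

end AllocationMean

section Envelope

/-- Payoff over both periods before the payment to the first seller. -/
noncomputable def gross (q x : Fin N → ℝ) (i : Fin N) : ℝ :=
  M.allocationMean q i (x i) (fun k => secondAuctionSurplus (Finset.univ.erase k) x i)
    (secondAuctionSurplus Finset.univ x i)

/-- Probability of getting a unit in either period. -/
noncomputable def winProb (q x : Fin N → ℝ) (i : Fin N) : ℝ :=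
  M.allocationMean q i 1 (fun k => secondAuctionWin (Finset.univ.erase k) x i)
    (secondAuctionWin Finset.univ x i)

/-- Expectation of `winProb` for a buyer of type `x` who reports `q`, the others being truthful. -/
noncomputable def interimWin (i : Fin N) (q x : ℝ) : ℝ :=
  ∫ y, M.winProb (Function.update y i q) (Function.update y i x) i ∂D.jointLaw N

lemma payoff_eq_gross_sub (q x : Fin N → ℝ) (i : Fin N) :
    M.payoff q x i = M.gross q x i - M.t q i := rfl

variable {q x : Fin N → ℝ} {i : Fin N}

lemma winProb_mem_Icc (hq : ∀ j, q j ∈ Set.Icc D.lo D.hi) : M.winProb q x i ∈ Set.Icc 0 1 :=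
  M.allocationMean_mem_Icc hq (Set.right_mem_Icc.mpr zero_le_one)
    (fun _ => secondAuctionWin_mem_Icc) secondAuctionWin_mem_Icc

lemma gross_mem_Icc (hN : 3 ≤ N) (hq : ∀ j, q j ∈ Set.Icc D.lo D.hi)
    (hx : ∀ j, x j ∈ Set.Icc D.lo D.hi) : M.gross q x i ∈ Set.Icc 0 D.hi := by
  have hx0 (j : Fin N) : 0 ≤ x j := D.lo_nonneg.trans (hx j).1
  have hsurplus {s : Finset (Fin N)} (hs : 1 ≤ (s.erase i).card) :
      secondAuctionSurplus s x i ∈ Set.Icc 0 D.hi :=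
    ⟨secondAuctionSurplus_nonneg, (secondAuctionSurplus_le hs hx0).trans (hx i).2⟩
  exact M.allocationMean_mem_Icc hq ⟨hx0 i, (hx i).2⟩
    (fun k => hsurplus (one_le_card_univ_erase_erase hN k i))
    (hsurplus (one_le_card_univ_erase hN i))

lemma isSubgradientOn_gross (hq : ∀ j, q j ∈ Set.Icc D.lo D.hi) (y : Fin N → ℝ) :
    IsSubgradientOn (fun x => M.winProb q (Function.update y i x) i)
      (fun x => M.gross q (Function.update y i x) i) Set.univ := by
  intro x hx z hz
  have hsub (s : Finset (Fin N)) := isSubgradientOn_secondAuctionSurplus s y i x hx z hz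
  simp only [gross, winProb, Function.update_self]
  rw [← allocationMean_add_mul]
  exact M.allocationMean_mono hq (by linarith) (fun k => hsub _) (hsub _)

lemma measurable_gross (hN : 3 ≤ N) (i : Fin N) :
    Measurable fun p : (Fin N → ℝ) × (Fin N → ℝ) => M.gross p.1 p.2 i :=
  M.measurable_allocationMean i (measurable_pi_apply i)
    (fun k => measurable_secondAuctionSurplus (one_le_card_univ_erase_erase hN k i))
    (measurable_secondAuctionSurplus (one_le_card_univ_erase hN i))

lemma measurable_winProb (hN : 3 ≤ N) (i : Fin N) :
    Measurable fun p : (Fin N → ℝ) × (Fin N → ℝ) => M.winProb p.1 p.2 i :=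
  M.measurable_allocationMean i measurable_const
    (fun k => measurable_secondAuctionWin (one_le_card_univ_erase_erase hN k i))
    (measurable_secondAuctionWin (one_le_card_univ_erase hN i))

lemma integrable_gross_update (hN : 3 ≤ N) (i : Fin N) {q x : ℝ} (hq : q ∈ Set.Icc D.lo D.hi)
    (hx : x ∈ Set.Icc D.lo D.hi) :
    Integrable (fun y => M.gross (Function.update y i q) (Function.update y i x) i)
      (D.jointLaw N) := by
  refine Integrable.of_mem_Icc 0 D.hi
    ((M.measurable_gross hN i).comp (measurable_update_update i q x)).aemeasurable ?_
  filter_upwards [ae_forall_update_mem_Icc i hq, ae_forall_update_mem_Icc i hx] with y hyq hyx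
    using M.gross_mem_Icc hN hyq hyx

lemma integrable_winProb_update (hN : 3 ≤ N) (i : Fin N) {q : ℝ} (hq : q ∈ Set.Icc D.lo D.hi)
    (x : ℝ) :
    Integrable (fun y => M.winProb (Function.update y i q) (Function.update y i x) i)
      (D.jointLaw N) := by
  refine Integrable.of_mem_Icc 0 1
    ((M.measurable_winProb hN i).comp (measurable_update_update i q x)).aemeasurable ?_
  filter_upwards [ae_forall_update_mem_Icc i hq] with y hy using M.winProb_mem_Icc hy

lemma integrable_gross (hN : 3 ≤ N) (i : Fin N) :
    Integrable (fun x => M.gross x x i) (D.jointLaw N) := by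
  refine Integrable.of_mem_Icc 0 D.hi
    ((M.measurable_gross hN i).comp (measurable_id.prodMk measurable_id)).aemeasurable ?_
  filter_upwards [D.ae_forall_mem_Icc] with x hx using M.gross_mem_Icc hN hx hx

lemma integrable_winProb_mul_sub_psi (hN : 3 ≤ N) (i : Fin N) :
    Integrable (fun x => M.winProb x x i * (x i - D.psi (x i))) (D.jointLaw N) := by
  refine ((D.measurePreserving_eval i).integrable_comp_of_integrable D.integrable_sub_psi).bdd_mul
    (c := 1)
    ((M.measurable_winProb hN i).comp (measurable_id.prodMk measurable_id)).aestronglyMeasurable ?_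
  filter_upwards [D.ae_forall_mem_Icc] with x hx
  have hwin := M.winProb_mem_Icc (x := x) (i := i) hx
  rw [Real.norm_of_nonneg hwin.1]
  exact hwin.2

lemma isSubgradientOn_interimPayoff (hN : 3 ≤ N) (i : Fin N) {q : ℝ}
    (hq : q ∈ Set.Icc D.lo D.hi) :
    IsSubgradientOn (M.interimWin i q) (M.interimPayoff i q) (Set.Icc D.lo D.hi) := by
  refine isSubgradientOn_integral ?_ (fun x _ => M.integrable_winProb_update hN i hq x)
    fun x hx => (M.integrable_gross_update hN i hq hx).sub (M.integrable_t_update i q hq)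
  filter_upwards [ae_forall_update_mem_Icc i hq] with y hy x _ z _
  have hgross := M.isSubgradientOn_gross (i := i) hy y x trivial z trivial
  simp only [payoff_eq_gross_sub] at hgross ⊢
  linarith

variable {M}

lemma IncentiveCompatible.isSubgradientOn (hM : M.IncentiveCompatible) (hN : 3 ≤ N) (i : Fin N) :
    IsSubgradientOn (fun z => M.interimWin i z z) (fun z => M.interimPayoff i z z)
      (Set.Icc D.lo D.hi) := fun x hx z hz =>
  (M.isSubgradientOn_interimPayoff hN i hx x hx z hz).trans (hM i z hz x hx)

lemma integral_interimWin_mul_sub_psi (hN : 3 ≤ N) (i : Fin N) :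
    ∫ z, M.interimWin i z z * (z - D.psi z) ∂D.law =
      ∫ x, M.winProb x x i * (x i - D.psi (x i)) ∂D.jointLaw N := by
  rw [D.integral_jointLaw_eq_integral_update i (M.integrable_winProb_mul_sub_psi hN i)]
  simp only [Function.update_self, integral_mul_const, interimWin]

lemma IncentiveCompatible.integral_t (hM : M.IncentiveCompatible) (hN : 3 ≤ N) (i : Fin N) :
    ∫ x, M.t x i ∂D.jointLaw N =
      ∫ x, (M.gross x x i - M.winProb x x i * (x i - D.psi (x i))) ∂D.jointLaw N
        - M.interimPayoff i D.lo D.lo := by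
  have hpayoff : ∫ x, (M.gross x x i - M.t x i) ∂D.jointLaw N =
      ∫ z, M.interimPayoff i z z ∂D.law :=
    D.integral_jointLaw_eq_integral_update i ((M.integrable_gross hN i).sub (M.integrable_t i))
  rw [D.integral_law_of_isSubgradientOn (hM.isSubgradientOn hN i),
    integral_interimWin_mul_sub_psi hN i,
    integral_sub (M.integrable_gross hN i) (M.integrable_t i)] at hpayoff
  rw [integral_sub (M.integrable_gross hN i) (M.integrable_winProb_mul_sub_psi hN i)]
  linarith

end Envelope

end DirectMechanism

end ValueDistribution

namespace ValueDistribution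

section VirtualSurplus

variable (D : ValueDistribution) {N : ℕ} {x : Fin N → ℝ} {a b c : Fin N}

/-- The virtual surplus from allocating the first good to the second-highest type rather than
withholding it. -/
noncomputable def virtualSurplus (x : Fin N → ℝ) : ℝ :=
  D.psi (kthHighest Finset.univ x 2) + kthHighest Finset.univ x 2 - kthHighest Finset.univ x 3

/-- The change in virtual surplus over both periods if the first good is allocated to buyer `k`
rather than withheld. -/
noncomputable def allocationGain (x : Fin N → ℝ) (k : Fin N) : ℝ :=
  D.psi (x k) + D.secondAuctionVirtualSurplus (Finset.univ.erase k) x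
    - D.secondAuctionVirtualSurplus Finset.univ x

lemma virtualSurplus_eq (hab : IsTopTwo Finset.univ x a b)
    (hbc : IsTopTwo (Finset.univ.erase a) x b c) :
    D.virtualSurplus x = D.psi (x b) + x b - x c := by
  rw [virtualSurplus, hab.kthHighest_two, hab.kthHighest_three hbc]

lemma allocationGain_left (hab : IsTopTwo Finset.univ x a b)
    (hbc : IsTopTwo (Finset.univ.erase a) x b c) :
    D.allocationGain x a = D.virtualSurplus x := by
  rw [D.virtualSurplus_eq hab hbc, allocationGain, secondAuctionVirtualSurplus,
    secondAuctionVirtualSurplus, hab.kthHighest_one, hab.kthHighest_two, hbc.kthHighest_one,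
    hbc.kthHighest_two]
  ring

lemma allocationGain_right (hab : IsTopTwo Finset.univ x a b)
    (hbc : IsTopTwo (Finset.univ.erase a) x b c) :
    D.allocationGain x b = D.virtualSurplus x := by
  have hac := hab.erase_right hbc
  rw [D.virtualSurplus_eq hab hbc, allocationGain, secondAuctionVirtualSurplus,
    secondAuctionVirtualSurplus, hab.kthHighest_one, hab.kthHighest_two, hac.kthHighest_one,
    hac.kthHighest_two]
  ring

lemma allocationGain_of_ne (hab : IsTopTwo Finset.univ x a b) {k : Fin N} (hka : k ≠ a)
    (hkb : k ≠ b) : D.allocationGain x k = D.psi (x k) := by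
  have hab' := hab.erase_of_ne hka hkb
  rw [allocationGain, secondAuctionVirtualSurplus, secondAuctionVirtualSurplus, hab.kthHighest_one,
    hab.kthHighest_two, hab'.kthHighest_one, hab'.kthHighest_two]
  ring

lemma exists_isTopTwo_isTopTwo_erase_univ (hN : 3 ≤ N) (hx : Function.Injective x) :
    ∃ a b c, IsTopTwo Finset.univ x a b ∧ IsTopTwo (Finset.univ.erase a) x b c :=
  exists_isTopTwo_isTopTwo_erase (by rwa [Finset.card_univ, Fintype.card_fin]) hx.injOn

variable {D}

lemma allocationGain_le_virtualSurplus (hN : 3 ≤ N) (hψ : MonotoneOn D.psi (Set.Ioo D.lo D.hi))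
    (hx : Function.Injective x) (hmem : ∀ j, x j ∈ Set.Ioo D.lo D.hi) (k : Fin N) :
    D.allocationGain x k ≤ D.virtualSurplus x := by
  obtain ⟨a, b, c, hab, hbc⟩ := exists_isTopTwo_isTopTwo_erase_univ hN hx
  rcases eq_or_ne k a with rfl | hka
  · exact (D.allocationGain_left hab hbc).le
  rcases eq_or_ne k b with rfl | hkb
  · exact (D.allocationGain_right hab hbc).le
  have hψkb := hψ (hmem k) (hmem b) (hab.le_right (Finset.mem_univ k) hka)
  rw [D.allocationGain_of_ne hab hka hkb, D.virtualSurplus_eq hab hbc]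
  linarith [hbc.lt]

lemma integrable_max_virtualSurplus (hN : 3 ≤ N) :
    Integrable (fun x : Fin N → ℝ => max (D.virtualSurplus x) 0) (D.jointLaw N) := by
  have hcard : (Finset.univ : Finset (Fin N)).card = N := by simp
  have hmeas₂ : Measurable fun x : Fin N → ℝ => kthHighest Finset.univ x 2 :=
    measurable_kthHighest (by norm_num) (by omega)
  have hmeas₃ : Measurable fun x : Fin N → ℝ => kthHighest Finset.univ x 3 :=
    measurable_kthHighest (by norm_num) (by omega)
  refine Integrable.of_mem_Icc 0 (2 * D.hi) ((((D.measurable_psi.comp hmeas₂).add hmeas₂).sub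
    hmeas₃).max measurable_const).aemeasurable ?_
  filter_upwards [D.ae_forall_mem_Icc] with x hx
  have hmem₂ : kthHighest Finset.univ x 2 ∈ Set.Icc D.lo D.hi :=
    kthHighest_mem (by norm_num) (by omega) fun j _ => hx j
  have hmem₃ : kthHighest Finset.univ x 3 ∈ Set.Icc D.lo D.hi :=
    kthHighest_mem (by norm_num) (by omega) fun j _ => hx j
  have hlo := D.lo_nonneg
  have hψ_le := D.psi_le_self (kthHighest Finset.univ x 2)
  refine ⟨le_max_right _ _, max_le ?_ (by linarith [hmem₂.1, hmem₂.2])⟩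
  unfold virtualSurplus
  linarith [hmem₂.2, hmem₃.1]

end VirtualSurplus

section OutsideOption

variable (D : ValueDistribution) {N : ℕ}

lemma outsideOption_nonneg (i : Fin N) (x : ℝ) : 0 ≤ D.outsideOption i x :=
  integral_nonneg fun _ => secondAuctionSurplus_nonneg

lemma outsideOption_lo (hN : 3 ≤ N) (i : Fin N) : D.outsideOption i D.lo = 0 := by
  refine integral_eq_zero_of_ae ?_
  filter_upwards [D.ae_forall_mem_Icc] with y hy
  have hle : D.lo ≤ kthHighest (Finset.univ.erase i) y 1 :=
    kthHighest_mem (A := Set.Ici D.lo) le_rfl (one_le_card_univ_erase hN i) fun j _ => (hy j).1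
  rw [secondAuctionSurplus_update]
  exact max_eq_right (sub_nonpos.mpr hle)

end OutsideOption

namespace DirectMechanism

variable {D : ValueDistribution} {N : ℕ}

section Withholding

/-- The mechanism that withholds the first good and charges nothing. -/
def withholding (D : ValueDistribution) (N : ℕ) : D.DirectMechanism N where
  P _ _ := 0
  t _ _ := 0
  measurable_P _ := measurable_const
  P_nonneg _ _ _ := le_rfl
  sum_P_le_one _ _ := by simp
  measurable_t _ := measurable_const
  integrable_t _ := integrable_zero _ _ _
  integrable_t_update _ _ _ := integrable_zero _ _ _

lemma interimPayoff_withholding (i : Fin N) (q x : ℝ) :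
    (withholding D N).interimPayoff i q x = D.outsideOption i x := by
  simp [interimPayoff, payoff, withholding, outsideOption]

lemma incentiveCompatible_withholding : (withholding D N).IncentiveCompatible := fun i x _ q _ => by
  rw [interimPayoff_withholding, interimPayoff_withholding]

lemma revenue_withholding : (withholding D N).revenue = 0 := by simp [revenue, withholding]

end Withholding

section Revenue

variable (M : D.DirectMechanism N)

lemma sum_gross_sub_winProb_mul (hN : 3 ≤ N) {x : Fin N → ℝ} (hx : Function.Injective x)
    (q : Fin N → ℝ) :
    ∑ i, (M.gross q x i - M.winProb q x i * (x i - D.psi (x i))) =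
      ∑ k, M.P q k * D.allocationGain x k + D.secondAuctionVirtualSurplus Finset.univ x := by
  have hmean (i : Fin N) : M.gross q x i - M.winProb q x i * (x i - D.psi (x i)) =
      M.allocationMean q i (D.psi (x i))
        (fun k => secondAuctionSurplus (Finset.univ.erase k) x i -
          secondAuctionWin (Finset.univ.erase k) x i * (x i - D.psi (x i)))
        (secondAuctionSurplus Finset.univ x i -
          secondAuctionWin Finset.univ x i * (x i - D.psi (x i))) := by
    have h := M.allocationMean_add_mul q i (x i) 1 (secondAuctionSurplus Finset.univ x i)
      (secondAuctionWin Finset.univ x i) (-(x i - D.psi (x i)))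
      (fun k => secondAuctionSurplus (Finset.univ.erase k) x i)
      (fun k => secondAuctionWin (Finset.univ.erase k) x i)
    convert h.symm using 1
    · simp only [gross, winProb]; ring
    · congr 1
      · ring
      · funext k; ring
      · ring
  have hcard : 2 ≤ (Finset.univ : Finset (Fin N)).card := by
    rw [Finset.card_univ, Fintype.card_fin]; omega
  have hcard_erase (k : Fin N) : 2 ≤ (Finset.univ.erase k).card := by rw [card_univ_erase]; omega
  simp only [hmean, sum_allocationMean, D.sum_secondAuctionSurplus_sub_win_mul hcard hx.injOn,
    D.sum_secondAuctionSurplus_sub_win_mul (hcard_erase _) hx.injOn, allocationGain]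

lemma integrable_gross_sub_winProb_mul (hN : 3 ≤ N) (i : Fin N) :
    Integrable (fun x => M.gross x x i - M.winProb x x i * (x i - D.psi (x i))) (D.jointLaw N) :=
  (M.integrable_gross hN i).sub (M.integrable_winProb_mul_sub_psi hN i)

lemma integrable_sum_gross_sub_winProb_mul (hN : 3 ≤ N) :
    Integrable (fun x => ∑ i, (M.gross x x i - M.winProb x x i * (x i - D.psi (x i))))
      (D.jointLaw N) :=
  integrable_finsetSum _ fun i _ => M.integrable_gross_sub_winProb_mul hN i

lemma integrable_secondAuctionVirtualSurplus_univ (hN : 3 ≤ N) :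
    Integrable (D.secondAuctionVirtualSurplus Finset.univ) (D.jointLaw N) := by
  refine ((withholding D N).integrable_sum_gross_sub_winProb_mul hN).congr ?_
  filter_upwards [D.ae_injective] with x hx
  simp [sum_gross_sub_winProb_mul _ hN hx, withholding]

lemma integrable_sum_mul_allocationGain (hN : 3 ≤ N) :
    Integrable (fun x => ∑ k, M.P x k * D.allocationGain x k) (D.jointLaw N) := by
  refine ((M.integrable_sum_gross_sub_winProb_mul hN).sub
    (integrable_secondAuctionVirtualSurplus_univ hN)).congr ?_
  filter_upwards [D.ae_injective] with x hx
  rw [Pi.sub_apply, M.sum_gross_sub_winProb_mul hN hx, add_sub_cancel_right]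

variable {M}

lemma IncentiveCompatible.revenue_eq_add (hM : M.IncentiveCompatible) (hN : 3 ≤ N) :
    M.revenue = ∫ x, ∑ k, M.P x k * D.allocationGain x k ∂D.jointLaw N
      + ∫ x, D.secondAuctionVirtualSurplus Finset.univ x ∂D.jointLaw N
      - ∑ i, M.interimPayoff i D.lo D.lo := by
  rw [← integral_add (M.integrable_sum_mul_allocationGain hN)
    (integrable_secondAuctionVirtualSurplus_univ hN), revenue,
    integral_finsetSum _ fun i _ => M.integrable_t i,
    Finset.sum_congr rfl fun i _ => hM.integral_t hN i, Finset.sum_sub_distrib,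
    ← integral_finsetSum _ fun i _ => M.integrable_gross_sub_winProb_mul hN i]
  congr 1
  refine integral_congr_ae ?_
  filter_upwards [D.ae_injective] with x hx using M.sum_gross_sub_winProb_mul hN hx x

/-- Comparison with withholding the good, where revenue and lowest-type payoffs vanish. -/
lemma integral_secondAuctionVirtualSurplus_univ (hN : 3 ≤ N) :
    ∫ x, D.secondAuctionVirtualSurplus Finset.univ x ∂D.jointLaw N = 0 := by
  have h := (incentiveCompatible_withholding (D := D) (N := N)).revenue_eq_add hN
  simp only [revenue_withholding, interimPayoff_withholding, D.outsideOption_lo hN] at h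
  simpa [withholding] using h.symm

lemma IncentiveCompatible.revenue_eq (hM : M.IncentiveCompatible) (hN : 3 ≤ N) :
    M.revenue = ∫ x, ∑ k, M.P x k * D.allocationGain x k ∂D.jointLaw N
      - ∑ i, M.interimPayoff i D.lo D.lo := by
  rw [hM.revenue_eq_add hN, integral_secondAuctionVirtualSurplus_univ hN, add_zero]

lemma IncentiveCompatible.revenue_le (hM : M.IncentiveCompatible) (hIR : M.IndividuallyRational)
    (hN : 3 ≤ N) (hψ : MonotoneOn D.psi (Set.Ioo D.lo D.hi)) :
    M.revenue ≤ ∫ x, max (D.virtualSurplus x) 0 ∂D.jointLaw N := by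
  have hlo : 0 ≤ ∑ i, M.interimPayoff i D.lo D.lo := Finset.sum_nonneg fun i _ =>
    (D.outsideOption_nonneg i _).trans (hIR i _ D.lo_mem_Icc)
  rw [hM.revenue_eq hN]
  refine (sub_le_self _ hlo).trans (integral_mono_ae (M.integrable_sum_mul_allocationGain hN)
    (integrable_max_virtualSurplus hN) ?_)
  filter_upwards [D.ae_injective, D.ae_forall_mem_Ioo] with x hx hmem
  have hmem' (j : Fin N) := Set.Ioo_subset_Icc_self (hmem j)
  calc ∑ k, M.P x k * D.allocationGain x k ≤ ∑ k, M.P x k * max (D.virtualSurplus x) 0 :=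
        Finset.sum_le_sum fun k _ => mul_le_mul_of_nonneg_left
          ((allocationGain_le_virtualSurplus hN hψ hx hmem k).trans (le_max_left _ _))
          (M.P_nonneg x hmem' k)
    _ = (∑ k, M.P x k) * max (D.virtualSurplus x) 0 := (Finset.sum_mul _ _ _).symm
    _ ≤ max (D.virtualSurplus x) 0 :=
        mul_le_of_le_one_left (le_max_right _ _) (M.sum_P_le_one x hmem')

lemma IncentiveCompatible.revenue_eq_integral_max (hM : M.IncentiveCompatible) (hN : 3 ≤ N)
    (hlo : ∀ i, M.interimPayoff i D.lo D.lo = 0)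
    (hP : ∀ᵐ x ∂D.jointLaw N, ∀ k, M.P x k =
      if x k = kthHighest Finset.univ x 2 ∧ 0 ≤ D.virtualSurplus x then 1 else 0) :
    M.revenue = ∫ x, max (D.virtualSurplus x) 0 ∂D.jointLaw N := by
  rw [hM.revenue_eq hN, Finset.sum_eq_zero fun i _ => hlo i, sub_zero]
  refine integral_congr_ae ?_
  filter_upwards [hP, D.ae_injective] with x hP hx
  obtain ⟨a, b, c, hab, hbc⟩ := exists_isTopTwo_isTopTwo_erase_univ hN hx
  simp only [hP, hab.kthHighest_two, hx.eq_iff, ite_and, ite_mul, one_mul, zero_mul,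
    Finset.sum_ite_eq', Finset.mem_univ, if_true, D.allocationGain_right hab hbc]
  exact (max_def' _ _).symm

end Revenue

end DirectMechanism

end ValueDistribution

/-! ### A mechanism attaining the bound -/

section Rivals

variable {N : ℕ} {i j l a b : Fin N} {x y : Fin N → ℝ}

/-- The highest type among the rivals of buyer `i`, the paper's `Y₍₁₎`. -/
noncomputable def topRival (i : Fin N) (y : Fin N → ℝ) : ℝ := kthHighest (Finset.univ.erase i) y 1

/-- The second-highest type among the rivals of buyer `i`, the paper's `Y₍₂₎`. -/
noncomputable def secondRival (i : Fin N) (y : Fin N → ℝ) : ℝ :=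
  kthHighest (Finset.univ.erase i) y 2

@[simp]
lemma topRival_update (i : Fin N) (y : Fin N → ℝ) (z : ℝ) :
    topRival i (Function.update y i z) = topRival i y := kthHighest_erase_update i z

@[simp]
lemma secondRival_update (i : Fin N) (y : Fin N → ℝ) (z : ℝ) :
    secondRival i (Function.update y i z) = secondRival i y := kthHighest_erase_update i z

lemma two_le_card_univ_erase (hN : 3 ≤ N) (i : Fin N) : 2 ≤ (Finset.univ.erase i).card := by
  rw [card_univ_erase]; omega

lemma topRival_mem (hN : 3 ≤ N) {A : Set ℝ} (h : ∀ j ≠ i, y j ∈ A) : topRival i y ∈ A :=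
  kthHighest_mem le_rfl (one_le_card_univ_erase hN i) fun j hj => h j (Finset.ne_of_mem_erase hj)

lemma secondRival_mem (hN : 3 ≤ N) {A : Set ℝ} (h : ∀ j ≠ i, y j ∈ A) : secondRival i y ∈ A :=
  kthHighest_mem one_le_two (two_le_card_univ_erase hN i) fun j hj =>
    h j (Finset.ne_of_mem_erase hj)

lemma measurable_topRival (hN : 3 ≤ N) (i : Fin N) : Measurable (topRival i) :=
  measurable_kthHighest le_rfl (one_le_card_univ_erase hN i)

lemma measurable_secondRival (hN : 3 ≤ N) (i : Fin N) : Measurable (secondRival i) :=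
  measurable_kthHighest one_le_two (two_le_card_univ_erase hN i)

lemma le_secondRival (hN : 3 ≤ N) {t : ℝ} (hj : j ≠ i) (hl : l ≠ i) (hjl : j ≠ l)
    (htj : t ≤ y j) (htl : t ≤ y l) : t ≤ secondRival i y := by
  rw [secondRival, le_kthHighest_iff one_le_two (two_le_card_univ_erase hN i),
    ← Finset.card_pair hjl]
  exact Finset.card_le_card (by grind)

lemma topRival_lt_iff (h : IsTopTwo Finset.univ x a b) : topRival i x < x i ↔ i = a :=
  h.kthHighest_erase_one_lt_iff (Finset.mem_univ i)

lemma le_topRival (hN : 3 ≤ N) (hj : j ≠ i) : y j ≤ topRival i y := by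
  rw [topRival, le_kthHighest_iff le_rfl (one_le_card_univ_erase hN i), Nat.one_le_iff_ne_zero]
  exact Finset.card_ne_zero_of_mem (a := j) (by grind)

end Rivals

namespace ValueDistribution

variable (D : ValueDistribution) {N : ℕ} {i : Fin N} {q : ℝ} {y : Fin N → ℝ}

section Allocation

/-- Reporting `q`, buyer `i` has the second-highest report and gets the first unit. -/
def WinsAsSecond (i : Fin N) (q : ℝ) (y : Fin N → ℝ) : Prop :=
  q < topRival i y ∧ secondRival i y < q ∧ secondRival i y ≤ q + D.psi q

/-- Reporting `q`, buyer `i` has the highest report or gets the first unit. -/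
def PaysBid (i : Fin N) (q : ℝ) (y : Fin N → ℝ) : Prop :=
  topRival i y < q ∨ D.WinsAsSecond i q y

open scoped Classical in
/-- The highest rival that buyer `i` faces in the second auction if he has the highest report. -/
noncomputable def rivalPrice (i : Fin N) (y : Fin N → ℝ) : ℝ :=
  if secondRival i y ≤ topRival i y + D.psi (topRival i y) then secondRival i y else topRival i y

variable {D}

@[simp]
lemma winsAsSecond_update {z : ℝ} :
    D.WinsAsSecond i q (Function.update y i z) ↔ D.WinsAsSecond i q y := by
  simp only [WinsAsSecond, topRival_update, secondRival_update]

@[simp]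
lemma rivalPrice_update {z : ℝ} :
    D.rivalPrice i (Function.update y i z) = D.rivalPrice i y := by
  simp only [rivalPrice, topRival_update, secondRival_update]

lemma measurableSet_winsAsSecond (hN : 3 ≤ N) (i : Fin N) {q : (Fin N → ℝ) → ℝ}
    (hq : Measurable q) : MeasurableSet {y | D.WinsAsSecond i (q y) y} :=
  (measurableSet_lt hq (measurable_topRival hN i)).inter
    ((measurableSet_lt (measurable_secondRival hN i) hq).inter
      (measurableSet_le (measurable_secondRival hN i) (hq.add (D.measurable_psi.comp hq))))

lemma measurableSet_paysBid (hN : 3 ≤ N) (i : Fin N) (q : ℝ) :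
    MeasurableSet {y | D.PaysBid i q y} :=
  (measurableSet_lt (measurable_topRival hN i) measurable_const).union
    (measurableSet_winsAsSecond hN i measurable_const)

lemma measurable_rivalPrice (hN : 3 ≤ N) (i : Fin N) : Measurable (D.rivalPrice i) :=
  Measurable.ite (measurableSet_le (measurable_secondRival hN i)
    ((measurable_topRival hN i).add (D.measurable_psi.comp (measurable_topRival hN i))))
    (measurable_secondRival hN i) (measurable_topRival hN i)

lemma rivalPrice_mem (hN : 3 ≤ N) {A : Set ℝ} (h : ∀ j ≠ i, y j ∈ A) : D.rivalPrice i y ∈ A := by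
  unfold rivalPrice
  split_ifs
  · exact secondRival_mem hN h
  · exact topRival_mem hN h

lemma winsAsSecond_unique (hN : 3 ≤ N) {x : Fin N → ℝ} {j l : Fin N}
    (hj : D.WinsAsSecond j (x j) x) (hl : D.WinsAsSecond l (x l) x) : j = l := by
  wlog hle : x j ≤ x l generalizing j l
  · exact (this hl hj (not_le.mp hle).le).symm
  by_contra hne
  obtain ⟨m, hm, hmx⟩ : topRival l x ∈ {t | ∃ m ≠ l, x m = t} :=
    topRival_mem hN fun m hm => ⟨m, hm, rfl⟩
  have hlt : x l < x m := hmx ▸ hl.1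
  have hmj : m ≠ j := by rintro rfl; exact hlt.not_ge hle
  exact hj.2.1.not_ge (le_secondRival hN (Ne.symm hne) hmj hm.symm hle (hle.trans hlt.le))

lemma WinsAsSecond.secondRival_le_payThreshold (h : D.WinsAsSecond i q y) :
    secondRival i y ≤ D.payThreshold q := le_min h.2.1.le h.2.2

variable {x : Fin N → ℝ} {a b c : Fin N}

lemma winsAsSecond_iff (hab : IsTopTwo Finset.univ x a b)
    (hbc : IsTopTwo (Finset.univ.erase a) x b c) :
    D.WinsAsSecond i (x i) x ↔ 0 ≤ D.virtualSurplus x ∧ i = b := by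
  rw [WinsAsSecond, D.virtualSurplus_eq hab hbc, topRival, secondRival]
  rcases eq_or_ne i a with rfl | hia
  · rw [hab.kthHighest_erase_left_one]
    exact ⟨fun h => (h.1.not_gt hab.lt).elim, fun h => (hab.ne h.2).elim⟩
  rw [hab.kthHighest_erase_one_of_ne hia]
  rcases eq_or_ne i b with rfl | hib
  · rw [(hab.erase_right hbc).kthHighest_two]
    constructor <;> grind [hab.lt, hbc.lt]
  · rw [(hab.erase_of_ne hia hib).kthHighest_two]
    exact ⟨fun h => (h.2.1.not_ge (hab.le_right (Finset.mem_univ i) hia)).elim,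
      fun h => (hib h.2).elim⟩

open scoped Classical in
lemma rivalPrice_left (hab : IsTopTwo Finset.univ x a b)
    (hbc : IsTopTwo (Finset.univ.erase a) x b c) :
    D.rivalPrice a x = if 0 ≤ D.virtualSurplus x then x c else x b := by
  rw [rivalPrice, D.virtualSurplus_eq hab hbc, topRival, secondRival, hbc.kthHighest_one,
    hbc.kthHighest_two]
  simp only [add_comm (D.psi (x b)), sub_nonneg]

end Allocation

section PayingProbability

lemma jointLaw_real_forall_ne (i : Fin N) (A : Set ℝ) :
    (D.jointLaw N).real {y | ∀ l ≠ i, y l ∈ A} = D.law.real A ^ (N - 1) := by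
  have hbox : {y : Fin N → ℝ | ∀ l ≠ i, y l ∈ A} =
      Set.univ.pi fun l => if l = i then Set.univ else A := by
    ext y; simp only [Set.mem_ofPred_eq, Set.mem_univ_pi]; grind
  rw [hbox, jointLaw_real_univ_pi, ← Finset.mul_prod_erase _ _ (Finset.mem_univ i), if_pos rfl,
    probReal_univ, one_mul, Finset.prod_congr rfl fun l hl => by
      rw [if_neg (Finset.ne_of_mem_erase hl)], Finset.prod_const, card_univ_erase]

lemma jointLaw_real_mem_and_forall_ne {j : Fin N} (hji : j ≠ i) (B A : Set ℝ) :
    (D.jointLaw N).real {y | y j ∈ B ∧ ∀ l, l ≠ i → l ≠ j → y l ∈ A} =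
      D.law.real B * D.law.real A ^ (N - 2) := by
  have hbox : {y : Fin N → ℝ | y j ∈ B ∧ ∀ l, l ≠ i → l ≠ j → y l ∈ A} =
      Set.univ.pi fun l => if l = i then Set.univ else if l = j then B else A := by
    ext y; simp only [Set.mem_ofPred_eq, Set.mem_univ_pi]; grind
  have hj : j ∈ Finset.univ.erase i := Finset.mem_erase.mpr ⟨hji, Finset.mem_univ j⟩
  have hrest : ∀ l ∈ (Finset.univ.erase i).erase j,
      D.law.real (if l = i then Set.univ else if l = j then B else A) = D.law.real A :=
    fun l hl => by
      rw [if_neg (Finset.ne_of_mem_erase (Finset.mem_of_mem_erase hl)),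
        if_neg (Finset.ne_of_mem_erase hl)]
  rw [hbox, jointLaw_real_univ_pi, ← Finset.mul_prod_erase _ _ (Finset.mem_univ i), if_pos rfl,
    probReal_univ, one_mul, ← Finset.mul_prod_erase _ _ hj, if_neg hji, if_pos rfl,
    Finset.prod_congr rfl hrest, Finset.prod_const, Finset.card_erase_of_mem hj, card_univ_erase,
    Nat.sub_sub]

lemma paysBid_iff (hN : 3 ≤ N) (hy : Function.Injective y) (hq : ∀ j, y j ≠ q) :
    D.PaysBid i q y ↔ (∀ l ≠ i, y l < q) ∨
      ∃ j ∈ Finset.univ.erase i, q < y j ∧ ∀ l, l ≠ i → l ≠ j → y l ≤ D.payThreshold q := by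
  obtain ⟨a, b, h⟩ := exists_isTopTwo (two_le_card_univ_erase hN i) hy.injOn
  have hmem (l : Fin N) (hl : l ≠ i) : l ∈ Finset.univ.erase i :=
    Finset.mem_erase.mpr ⟨hl, Finset.mem_univ l⟩
  rw [PaysBid, WinsAsSecond, topRival, secondRival, h.kthHighest_one, h.kthHighest_two]
  refine or_congr ⟨fun hlt l hl => (h.le_left (hmem l hl)).trans_lt hlt,
    fun hlt => hlt a (Finset.ne_of_mem_erase h.left_mem)⟩ ⟨?_, ?_⟩
  · rintro ⟨hqa, hbq, hbψ⟩
    exact ⟨a, h.left_mem, hqa, fun l hl hla =>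
      (h.le_right (hmem l hl) hla).trans (le_min hbq.le hbψ)⟩
  · rintro ⟨j, hj, hqj, hle⟩
    have hja : j = a := by
      by_contra hja
      exact (hqj.trans_le (h.le_left hj)).not_ge
        ((hle a (Finset.ne_of_mem_erase h.left_mem) (Ne.symm hja)).trans (min_le_left _ _))
    subst hja
    have hb := le_min_iff.mp (hle b (Finset.ne_of_mem_erase h.right_mem) h.ne.symm)
    exact ⟨hqj, hb.1.lt_of_ne (hq b), hb.2⟩

lemma jointLaw_real_paysBid (hN : 3 ≤ N) (i : Fin N) (q : ℝ) :
    (D.jointLaw N).real {y | D.PaysBid i q y} = D.payProb N q := by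
  set highest : Set (Fin N → ℝ) := {y | ∀ l ≠ i, y l ∈ Set.Iio q}
  set second : Fin N → Set (Fin N → ℝ) := fun j =>
    {y | y j ∈ Set.Ioi q ∧ ∀ l, l ≠ i → l ≠ j → y l ∈ Set.Iic (D.payThreshold q)}
  have hpays : {y | D.PaysBid i q y} =ᵐ[D.jointLaw N]
      (highest ∪ ⋃ j ∈ Finset.univ.erase i, second j : Set (Fin N → ℝ)) := by
    filter_upwards [D.ae_injective, D.ae_forall_ne q] with y hy hq
    have hiff : D.PaysBid i q y ↔ y ∈ highest ∪ ⋃ j ∈ Finset.univ.erase i, second j := by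
      simp only [D.paysBid_iff hN hy hq, Set.mem_union, Set.mem_iUnion, exists_prop]
      rfl
    exact propext hiff
  have hmeas (j : Fin N) : MeasurableSet (second j) := by
    simp only [second, Set.ofPred_and, Set.ofPred_forall]
    measurability
  have hdisj : Disjoint highest (⋃ j ∈ Finset.univ.erase i, second j) := by
    simp only [Set.disjoint_left, Set.mem_iUnion, not_exists]
    exact fun y hy j hj hyj => lt_asymm (Set.mem_Ioi.mp hyj.1) (hy j (Finset.ne_of_mem_erase hj))
  have hpair : Set.PairwiseDisjoint (Finset.univ.erase i : Finset (Fin N)) second := by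
    refine fun j hj l _ hjl => Set.disjoint_left.mpr fun y hyj hyl => ?_
    have hyj_le : y j ≤ D.payThreshold q := hyl.2 j (Finset.ne_of_mem_erase hj) hjl
    exact (Set.mem_Ioi.mp hyj.1).not_ge (hyj_le.trans (min_le_left _ _))
  rw [measureReal_congr hpays,
    measureReal_union hdisj (Finset.measurableSet_biUnion _ fun j _ => hmeas j)
      (measure_ne_top _ _) (measure_ne_top _ _),
    measureReal_biUnion_finset hpair (fun j _ => hmeas j) fun _ _ => measure_ne_top _ _,
    Finset.sum_congr rfl fun j hj =>
      D.jointLaw_real_mem_and_forall_ne (Finset.ne_of_mem_erase hj) _ _,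
    Finset.sum_const, card_univ_erase, nsmul_eq_mul, jointLaw_real_forall_ne, law_real_Iio,
    law_real_Ioi, payProb, Nat.cast_pred (by omega)]
  change _ + _ * (_ * D.F (D.payThreshold q) ^ (N - 2)) = _
  ring

end PayingProbability

end ValueDistribution

namespace ValueDistribution

variable {D : ValueDistribution} {N : ℕ} {i : Fin N} {q x z : ℝ} {y : Fin N → ℝ}

lemma rivalPrice_le_topRival (hN : 3 ≤ N) : D.rivalPrice i y ≤ topRival i y :=
  rivalPrice_mem (A := Set.Iic (topRival i y)) hN fun _ => le_topRival hN

lemma ae_injective_update (i : Fin N) (q : ℝ) :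
    ∀ᵐ y ∂D.jointLaw N, Function.Injective (Function.update y i q) := by
  filter_upwards [D.ae_injective, D.ae_forall_ne q] with y hy hq j l hjl
  have := hy.eq_iff (a := j) (b := l)
  have := hq j
  have := hq l
  grind [Function.update_apply]

section OptimalPayment

variable (D) in
/-- The bid function, extended beyond the range of types by constants to make it measurable. -/
noncomputable def extendedBid (N : ℕ) : ℝ → ℝ :=
  Set.IccExtend D.lo_lt_hi.le (Set.domRestrict _ (D.bid N))

lemma extendedBid_eq (hx : x ∈ Set.Icc D.lo D.hi) : D.extendedBid N x = D.bid N x :=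
  Set.IccExtend_of_mem _ _ hx

variable (D) in
open scoped Classical in
/-- What buyer `i` pays in the optimal mechanism when the reports are `x`: his net payment in the
modified pay-your-bid auction if all valuations are as reported and everybody bids accordingly. -/
noncomputable def optimalPayment (x : Fin N → ℝ) (i : Fin N) : ℝ :=
  if topRival i x < x i then D.extendedBid N (x i) - D.rivalPrice i x
  else if D.WinsAsSecond i (x i) x then D.extendedBid N (x i) else 0

open scoped Classical in
lemma optimalPayment_update (hq : q ∈ Set.Icc D.lo D.hi) :
    D.optimalPayment (Function.update y i q) i =
      if topRival i y < q then D.bid N q - D.rivalPrice i y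
      else if D.WinsAsSecond i q y then D.bid N q else 0 := by
  simp only [optimalPayment, topRival_update, Function.update_self, winsAsSecond_update,
    rivalPrice_update, extendedBid_eq hq]

variable (hN : 3 ≤ N) (hψ : MonotoneOn D.psi (Set.Ioo D.lo D.hi))
  (hdiff : DifferentiableOn ℝ D.psi (Set.Ioo (D.a 0) D.psiInvZero))

include hN hψ hdiff

lemma measurable_extendedBid : Measurable (D.extendedBid N) :=
  (D.bid_strictMonoOn hN hψ hdiff).domRestrict.monotone.IccExtend _ |>.measurable

lemma measurable_optimalPayment (i : Fin N) :
    Measurable fun x : Fin N → ℝ => D.optimalPayment x i := by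
  have hbid := (measurable_extendedBid hN hψ hdiff).comp (measurable_pi_apply (X := fun _ => ℝ) i)
  exact Measurable.ite (measurableSet_lt (measurable_topRival hN i) (measurable_pi_apply i))
    (hbid.sub (measurable_rivalPrice hN i))
    (Measurable.ite (measurableSet_winsAsSecond hN i (measurable_pi_apply i)) hbid
      measurable_const)

lemma optimalPayment_mem_Icc {x : Fin N → ℝ} (hx : ∀ j, x j ∈ Set.Icc D.lo D.hi) (i : Fin N) :
    D.optimalPayment x i ∈ Set.Icc (-D.hi) D.hi := by
  have hbid_nonneg := D.bid_nonneg hN hψ hdiff (hx i)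
  have hbid_le := (D.bid_le_self hN hψ hdiff (hx i)).trans (hx i).2
  have hprice : D.rivalPrice i x ∈ Set.Icc D.lo D.hi := rivalPrice_mem hN fun j _ => hx j
  have hlo := D.lo_nonneg
  rw [optimalPayment, extendedBid_eq (hx i)]
  split_ifs <;> constructor <;> linarith [hprice.1, hprice.2]

end OptimalPayment

section OptimalMechanism

variable (hN : 3 ≤ N) (hψ : MonotoneOn D.psi (Set.Ioo D.lo D.hi))
  (hdiff : DifferentiableOn ℝ D.psi (Set.Ioo (D.a 0) D.psiInvZero))

open scoped Classical in
/-- The direct mechanism that the modified pay-your-bid auction implements. -/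
noncomputable def optimalMechanism : D.DirectMechanism N where
  P x i := if D.WinsAsSecond i (x i) x then 1 else 0
  t x i := D.optimalPayment x i
  measurable_P i := Measurable.ite (measurableSet_winsAsSecond hN i (measurable_pi_apply i))
    measurable_const measurable_const
  P_nonneg _ _ _ := by split_ifs <;> norm_num
  sum_P_le_one x _ := by
    rw [Finset.sum_boole, Nat.cast_le_one, Finset.card_le_one]
    exact fun j hj l hl =>
      winsAsSecond_unique hN (Finset.mem_filter.mp hj).2 (Finset.mem_filter.mp hl).2
  measurable_t i := measurable_optimalPayment hN hψ hdiff i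
  integrable_t i := by
    refine Integrable.of_mem_Icc (-D.hi) D.hi
      (measurable_optimalPayment hN hψ hdiff i).aemeasurable ?_
    filter_upwards [D.ae_forall_mem_Icc] with x hx using optimalPayment_mem_Icc hN hψ hdiff hx i
  integrable_t_update i q hq := by
    refine Integrable.of_mem_Icc (-D.hi) D.hi ((measurable_optimalPayment hN hψ hdiff i).comp
      (measurable_update'.comp (measurable_id.prodMk measurable_const))).aemeasurable ?_
    filter_upwards [ae_forall_update_mem_Icc i hq] with y hy
      using optimalPayment_mem_Icc hN hψ hdiff hy i

open scoped Classical in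
lemma allocationMean_optimalMechanism {x : Fin N → ℝ} {a b c : Fin N}
    (hab : IsTopTwo Finset.univ x a b) (hbc : IsTopTwo (Finset.univ.erase a) x b c) (i : Fin N)
    (A C : ℝ) (B : Fin N → ℝ) :
    (optimalMechanism hN hψ hdiff).allocationMean x i A B C =
      if 0 ≤ D.virtualSurplus x then (if i = b then A else B b) else C := by
  simp only [DirectMechanism.allocationMean, optimalMechanism, winsAsSecond_iff hab hbc]
  by_cases hvs : 0 ≤ D.virtualSurplus x
  · simp only [hvs, true_and, if_true, ite_mul, one_mul, zero_mul, Finset.sum_ite_eq',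
      Finset.mem_erase, Finset.mem_univ, and_true]
    grind
  · simp [hvs]

open scoped Classical in
lemma allocationMean_optimalMechanism_topRival {x : Fin N → ℝ} (hx : Function.Injective x)
    (i : Fin N) (own : ℝ) (φ : ℝ → ℝ) :
    (optimalMechanism hN hψ hdiff).allocationMean x i own
        (fun k => φ (kthHighest ((Finset.univ.erase k).erase i) x 1)) (φ (topRival i x)) =
      if topRival i x < x i then φ (D.rivalPrice i x)
      else if D.WinsAsSecond i (x i) x then own else φ (topRival i x) := by
  obtain ⟨a, b, c, hab, hbc⟩ := exists_isTopTwo_isTopTwo_erase_univ hN hx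
  have hac := hab.erase_right hbc
  rw [allocationMean_optimalMechanism hN hψ hdiff hab hbc]
  simp only [topRival_lt_iff hab, winsAsSecond_iff hab hbc]
  rcases eq_or_ne i a with rfl | hia
  · rw [if_pos rfl, rivalPrice_left hab hbc, if_neg hab.ne, hac.kthHighest_erase_left_one,
      topRival, hab.kthHighest_erase_left_one, apply_ite φ]
  · rw [if_neg hia, topRival, hab.kthHighest_erase_one_of_ne hia,
      hac.kthHighest_erase_one_of_ne hia, ite_and]

open scoped Classical in
lemma gross_optimalMechanism (h : Function.Injective (Function.update y i q)) (z : ℝ) :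
    (optimalMechanism hN hψ hdiff).gross (Function.update y i q) (Function.update y i z) i =
      if topRival i y < q then max (z - D.rivalPrice i y) 0
      else if D.WinsAsSecond i q y then z else max (z - topRival i y) 0 := by
  have hmean := allocationMean_optimalMechanism_topRival hN hψ hdiff h i z fun p => max (z - p) 0
  simp only [kthHighest_erase_update, topRival_update, rivalPrice_update, winsAsSecond_update,
    Function.update_self] at hmean
  simp only [DirectMechanism.gross, secondAuctionSurplus_update, Function.update_self]
  exact hmean

open scoped Classical in
lemma winProb_optimalMechanism (h : Function.Injective (Function.update y i q)) (z : ℝ) :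
    (optimalMechanism hN hψ hdiff).winProb (Function.update y i q) (Function.update y i z) i =
      if topRival i y < q then (if D.rivalPrice i y < z then 1 else 0)
      else if D.WinsAsSecond i q y then 1 else (if topRival i y < z then 1 else 0) := by
  have hmean := allocationMean_optimalMechanism_topRival hN hψ hdiff h i 1
    fun p => if p < z then 1 else 0
  simp only [kthHighest_erase_update, topRival_update, rivalPrice_update, winsAsSecond_update,
    Function.update_self] at hmean
  simp only [DirectMechanism.winProb, secondAuctionWin_update]
  exact hmean

open scoped Classical in
lemma payoff_optimalMechanism (h : Function.Injective (Function.update y i q))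
    (hq : q ∈ Set.Icc D.lo D.hi) (z : ℝ) :
    (optimalMechanism hN hψ hdiff).payoff (Function.update y i q) (Function.update y i z) i =
      if topRival i y < q then max z (D.rivalPrice i y) - D.bid N q
      else if D.WinsAsSecond i q y then z - D.bid N q else max (z - topRival i y) 0 := by
  rw [DirectMechanism.payoff_eq_gross_sub, gross_optimalMechanism hN hψ hdiff h,
    show (optimalMechanism hN hψ hdiff).t = D.optimalPayment from rfl, optimalPayment_update hq]
  split_ifs
  · rw [← sub_self (D.rivalPrice i y), max_sub_sub_right]
    ring
  · rfl
  · rw [sub_zero]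

lemma interimPayoff_optimalMechanism_self (i : Fin N) (hx : x ∈ Set.Icc D.lo D.hi) :
    (optimalMechanism hN hψ hdiff).interimPayoff i x x = ∫ s in D.lo..x, D.payProb N s := by
  classical
  rw [← D.payProb_mul_sub_bid hN hψ hdiff hx, ← D.jointLaw_real_paysBid hN i x,
    ← integral_indicator_one (measurableSet_paysBid hN i x), ← integral_mul_const]
  refine integral_congr_ae ?_
  filter_upwards [ae_injective_update i x] with y hy
  have hprice : D.rivalPrice i y ≤ topRival i y := rivalPrice_le_topRival hN
  simp only [payoff_optimalMechanism hN hψ hdiff hy hx, Set.indicator_apply, Set.mem_ofPred_eq,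
    PaysBid, Pi.one_apply]
  by_cases htop : topRival i y < x
  · simp only [htop, true_or, if_true, one_mul, max_eq_left (hprice.trans htop.le)]
  · simp only [htop, false_or, if_false, max_eq_right (sub_nonpos.mpr (not_lt.mp htop))]
    split_ifs <;> simp

lemma interimPayoff_optimalMechanism_lo (i : Fin N) :
    (optimalMechanism hN hψ hdiff).interimPayoff i D.lo x = D.outsideOption i x := by
  classical
  refine integral_congr_ae ?_
  filter_upwards [ae_injective_update i D.lo, D.ae_forall_mem_Icc] with y hinj hy
  have htop : D.lo ≤ topRival i y := topRival_mem (A := Set.Ici D.lo) hN fun j _ => (hy j).1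
  have hsecond : D.lo ≤ secondRival i y :=
    secondRival_mem (A := Set.Ici D.lo) hN fun j _ => (hy j).1
  rw [payoff_optimalMechanism hN hψ hdiff hinj (D.lo_mem_Icc), if_neg htop.not_gt,
    if_neg fun h => hsecond.not_gt h.2.1, secondAuctionSurplus_update]
  rfl

end OptimalMechanism

end ValueDistribution

namespace ValueDistribution

variable {D : ValueDistribution} {N : ℕ}

namespace DirectMechanism

/-- A report above the true type wins with the probabilities `w` of the types in between at least,
and one below it at most, so that by the envelope formula neither is profitable. -/
lemma incentiveCompatible_of_interimWin {M : D.DirectMechanism N} (hN : 3 ≤ N) {w : ℝ → ℝ}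
    (hw : ContinuousOn w (Set.Icc D.lo D.hi))
    (hself : ∀ i, ∀ x ∈ Set.Icc D.lo D.hi, M.interimPayoff i x x = ∫ s in D.lo..x, w s)
    (hle : ∀ i, ∀ q ∈ Set.Icc D.lo D.hi, ∀ z ∈ Set.Icc q D.hi, M.interimWin i q z ≤ w z)
    (hge : ∀ i, ∀ q ∈ Set.Icc D.lo D.hi, ∀ z ∈ Set.Icc D.lo q, w z ≤ M.interimWin i q z) :
    M.IncentiveCompatible := by
  intro i x hx q hq
  have hw_int {u v : ℝ} (hu : u ∈ Set.Icc D.lo D.hi) (hv : v ∈ Set.Icc D.lo D.hi) :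
      IntervalIntegrable w volume u v :=
    (hw.mono (Set.ordConnected_Icc.uIcc_subset hu hv)).intervalIntegrable
  have henvelope {u v : ℝ} (hu : u ∈ Set.Icc D.lo D.hi) (hv : v ∈ Set.Icc D.lo D.hi) :
      IsSubgradientOn (M.interimWin i q) (M.interimPayoff i q) (Set.Icc u v) :=
    (M.isSubgradientOn_interimPayoff hN i hq).mono (Set.Icc_subset_Icc hu.1 hv.2)
  have hwin_int {u v : ℝ} (hu : u ∈ Set.Icc D.lo D.hi) (hv : v ∈ Set.Icc D.lo D.hi)
      (huv : u ≤ v) : IntervalIntegrable (M.interimWin i q) volume u v :=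
    (Set.uIcc_of_le huv ▸ (henvelope hu hv).monotoneOn).intervalIntegrable
  have hrent : M.interimPayoff i x x - M.interimPayoff i q q = ∫ z in q..x, w z := by
    rw [hself i x hx, hself i q hq, intervalIntegral.integral_interval_sub_left
      (hw_int D.lo_mem_Icc hx) (hw_int D.lo_mem_Icc hq)]
  rcases le_total q x with hqx | hxq
  · have hgain := (henvelope hq hx).integral_eq_sub hqx
    have hmono : ∫ z in q..x, M.interimWin i q z ≤ ∫ z in q..x, w z :=
      intervalIntegral.integral_mono_on hqx (hwin_int hq hx hqx) (hw_int hq hx)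
        fun z hz => hle i q hq z ⟨hz.1, hz.2.trans hx.2⟩
    linarith
  · have hgain := (henvelope hx hq).integral_eq_sub hxq
    have hmono : ∫ z in x..q, w z ≤ ∫ z in x..q, M.interimWin i q z :=
      intervalIntegral.integral_mono_on hxq (hw_int hx hq) (hwin_int hx hq hxq)
        fun z hz => hge i q hq z ⟨hx.1.trans hz.1, hz.2⟩
    rw [intervalIntegral.integral_symm] at hrent
    linarith

end DirectMechanism

section Optimality

variable {i : Fin N} {q z : ℝ} {y : Fin N → ℝ}

lemma WinsAsSecond.secondRival_le_payThreshold_of_le (hψ : MonotoneOn D.psi (Set.Ioo D.lo D.hi))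
    (h : D.WinsAsSecond i q y) (hq : D.lo < q) (hqz : q ≤ z) (hz : z ≤ D.hi) :
    secondRival i y ≤ D.payThreshold z :=
  h.secondRival_le_payThreshold.trans
    (payThreshold_monotoneOn hψ ⟨hq, hqz.trans hz⟩ ⟨hq.trans_le hqz, hz⟩ hqz)

lemma ae_topRival_ne (hN : 3 ≤ N) (i : Fin N) (q : ℝ) :
    ∀ᵐ y ∂D.jointLaw N, topRival i y ≠ q := by
  filter_upwards [D.ae_forall_ne q] with y hy
  exact topRival_mem (A := {q}ᶜ) hN fun j _ => hy j

lemma ae_lo_lt_secondRival (hN : 3 ≤ N) (i : Fin N) :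
    ∀ᵐ y ∂D.jointLaw N, D.lo < secondRival i y := by
  filter_upwards [D.ae_forall_mem_Ioo] with y hy
  exact secondRival_mem (A := Set.Ioi D.lo) hN fun j _ => (hy j).1

lemma WinsAsSecond.mono (hψ : MonotoneOn D.psi (Set.Ioo D.lo D.hi))
    (h : D.WinsAsSecond i q y) (hlo : D.lo < secondRival i y) (hqz : q ≤ z) (hz : z ≤ D.hi)
    (hzy : z < topRival i y) : D.WinsAsSecond i z y :=
  ⟨hzy, h.2.1.trans_le hqz, (h.secondRival_le_payThreshold_of_le hψ (hlo.trans h.2.1) hqz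
    hz).trans (min_le_right _ _)⟩

variable (hN : 3 ≤ N) (hψ : MonotoneOn D.psi (Set.Ioo D.lo D.hi))
  (hdiff : DifferentiableOn ℝ D.psi (Set.Ioo (D.a 0) D.psiInvZero))

lemma interimWin_optimalMechanism_le (i : Fin N) (hq : q ∈ Set.Icc D.lo D.hi)
    (hz : z ∈ Set.Icc q D.hi) :
    (optimalMechanism hN hψ hdiff).interimWin i q z ≤ D.payProb N z := by
  classical
  rw [← D.jointLaw_real_paysBid hN i z, ← integral_indicator_one (measurableSet_paysBid hN i z)]
  refine integral_mono_ae ((optimalMechanism hN hψ hdiff).integrable_winProb_update hN i hq z)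
    ((integrable_const 1).indicator (measurableSet_paysBid hN i z)) ?_
  filter_upwards [ae_forall_update_mem_Icc i hq, ae_injective_update i q, ae_topRival_ne hN i z,
    ae_lo_lt_secondRival hN i] with y hmem hinj hne hlo
  rw [Set.indicator_apply]
  split_ifs with hpays
  · exact ((optimalMechanism hN hψ hdiff).winProb_mem_Icc hmem).2
  have hzy : z < topRival i y := (not_lt.mp fun h => hpays (Or.inl h)).lt_of_ne hne.symm
  have hsecond : ¬ D.WinsAsSecond i q y := fun h => hpays (Or.inr (h.mono hψ hlo hz.1 hz.2 hzy))
  rw [winProb_optimalMechanism hN hψ hdiff hinj, if_neg (hz.1.trans_lt hzy).not_gt,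
    if_neg hsecond, if_neg hzy.not_gt]

lemma le_interimWin_optimalMechanism (i : Fin N) (hq : q ∈ Set.Icc D.lo D.hi) (hzq : z ≤ q) :
    D.payProb N z ≤ (optimalMechanism hN hψ hdiff).interimWin i q z := by
  classical
  rw [← D.jointLaw_real_paysBid hN i z, ← integral_indicator_one (measurableSet_paysBid hN i z)]
  refine integral_mono_ae ((integrable_const 1).indicator (measurableSet_paysBid hN i z))
    ((optimalMechanism hN hψ hdiff).integrable_winProb_update hN i hq z) ?_
  filter_upwards [ae_forall_update_mem_Icc i hq, ae_injective_update i q, ae_topRival_ne hN i q,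
    ae_lo_lt_secondRival hN i] with y hmem hinj hne hlo
  rw [Set.indicator_apply]
  split_ifs with hpays
  swap
  · exact ((optimalMechanism hN hψ hdiff).winProb_mem_Icc hmem).1
  rw [winProb_optimalMechanism hN hψ hdiff hinj, Pi.one_apply]
  rcases hpays with htop | hsecond
  · rw [if_pos (htop.trans_le hzq), if_pos ((rivalPrice_le_topRival hN).trans_lt htop)]
  rcases hne.lt_or_gt with htop | htop
  · have hthreshold := hsecond.secondRival_le_payThreshold_of_le hψ (hlo.trans hsecond.2.1)
      hsecond.1.le (htop.le.trans hq.2)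
    rw [if_pos htop, rivalPrice, if_pos (hthreshold.trans (min_le_right _ _)), if_pos hsecond.2.1]
  · rw [if_neg htop.not_gt, if_pos (hsecond.mono hψ hlo hzq hq.2 htop)]

lemma incentiveCompatible_optimalMechanism :
    (optimalMechanism hN hψ hdiff).IncentiveCompatible :=
  DirectMechanism.incentiveCompatible_of_interimWin hN (D.continuousOn_payProb hN)
    (fun i _ => interimPayoff_optimalMechanism_self hN hψ hdiff i)
    (fun i _ hq _ => interimWin_optimalMechanism_le hN hψ hdiff i hq)
    fun i _ hq _ hz => le_interimWin_optimalMechanism hN hψ hdiff i hq hz.2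

lemma individuallyRational_optimalMechanism :
    (optimalMechanism hN hψ hdiff).IndividuallyRational := fun i x hx => by
  rw [← interimPayoff_optimalMechanism_lo hN hψ hdiff]
  exact incentiveCompatible_optimalMechanism hN hψ hdiff i x hx D.lo D.lo_mem_Icc

lemma revenue_optimalMechanism : (optimalMechanism hN hψ hdiff).revenue =
    ∫ x : Fin N → ℝ, max (D.virtualSurplus x) 0 ∂D.jointLaw N := by
  refine (incentiveCompatible_optimalMechanism hN hψ hdiff).revenue_eq_integral_max hN
    (fun i => ?_) ?_
  · rw [interimPayoff_optimalMechanism_self hN hψ hdiff i D.lo_mem_Icc,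
      intervalIntegral.integral_same]
  filter_upwards [D.ae_injective] with x hx k
  obtain ⟨a, b, c, hab, hbc⟩ := exists_isTopTwo_isTopTwo_erase_univ hN hx
  simp only [optimalMechanism, winsAsSecond_iff hab hbc, hab.kthHighest_two, hx.eq_iff,
    and_comm (a := k = b)]

end Optimality

end ValueDistribution

/-! ### The modified pay-your-bid auction -/

section Ranking

variable {N : ℕ} {σ : Equiv.Perm (Fin N)} {s : Finset (Fin N)} {v : Fin N → ℝ} {a b c i : Fin N}

namespace IsTopTwo

lemma of_comp {g : ℝ → ℝ} (hg : Monotone g) (hv : Set.InjOn (g ∘ v) s)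
    (h : IsTopTwo s (g ∘ v) a b) : IsTopTwo s v a b where
  left_mem := h.left_mem
  right_mem := h.right_mem
  lt := hg.reflect_lt h.lt
  le_right j hj hja := by
    rcases eq_or_ne j b with rfl | hjb
    · rfl
    · exact (hg.reflect_lt ((h.le_right hj hja).lt_of_ne fun he =>
        hjb (hv hj h.right_mem he))).le

lemma lt_left (h : IsTopTwo s v a b) (hi : i ∈ s) (hia : i ≠ a) : v i < v a :=
  (h.le_right hi hia).trans_lt h.lt

lemma isKthHighest_one_iff (h : IsTopTwo s v a b) : IsKthHighest σ s v 1 i ↔ i = a := by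
  simp only [IsKthHighest, Nat.add_eq_right, Finset.card_eq_zero]
  constructor
  · rintro ⟨hi, hempty⟩
    by_contra hia
    exact Finset.eq_empty_iff_forall_notMem.mp hempty a
      (Finset.mem_filter.mpr ⟨h.left_mem, Or.inl (h.lt_left hi hia)⟩)
  · rintro rfl
    refine ⟨h.left_mem, Finset.filter_false_of_mem fun j hj => ?_⟩
    have hlt := h.lt_left (i := j) hj
    grind

lemma isKthHighest_two_iff (h : IsTopTwo s v a b) (h' : IsTopTwo (s.erase a) v b c) :
    IsKthHighest σ s v 2 i ↔ i = b := by
  have hlt (j : Fin N) (hj : j ∈ s) (hja : j ≠ a) (hjb : j ≠ b) : v j < v b :=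
    h'.lt_left (Finset.mem_erase.mpr ⟨hja, hj⟩) hjb
  simp only [IsKthHighest, Nat.reduceEqDiff]
  constructor
  · rintro ⟨hi, hcard⟩
    by_contra hib
    rcases eq_or_ne i a with rfl | hia
    · have hfirst := (h.isKthHighest_one_iff (σ := σ)).mpr rfl
      have := hfirst.2
      omega
    · have hpair : {a, b} ⊆ s.filter fun j => v i < v j ∨ v i = v j ∧ σ j < σ i := by
        grind [hlt i hi hia hib, h.lt, h.left_mem, h.right_mem]
      have := Finset.card_le_card hpair
      rw [Finset.card_pair h.ne] at this
      omega
  · rintro rfl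
    refine ⟨h.right_mem, Finset.card_eq_one.mpr ⟨a, ?_⟩⟩
    ext j
    grind [hlt j, h.lt, h.left_mem]

end IsTopTwo

open scoped Classical in
lemma ite_isKthHighest_one_kthHighest_two (hs : 2 ≤ s.card) (hv : Function.Injective v)
    (hi : i ∈ s) : (if IsKthHighest σ s v 1 i then kthHighest s v 2 else 0) =
      if kthHighest (s.erase i) v 1 < v i then kthHighest (s.erase i) v 1 else 0 := by
  obtain ⟨a, b, h⟩ := exists_isTopTwo hs hv.injOn
  simp only [h.isKthHighest_one_iff, h.kthHighest_erase_one_lt_iff hi]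
  split_ifs with hia
  · rw [hia, h.kthHighest_two, h.kthHighest_erase_left_one]
  · rfl

end Ranking

namespace ValueDistribution

variable {D : ValueDistribution} {N : ℕ} {β : ℝ → ℝ}

section InferredType

variable {p x : ℝ}

lemma inferredType_mem_Icc : D.inferredType β p ∈ Set.Icc D.lo D.hi :=
  ⟨le_max_left _ _, max_le D.lo_lt_hi.le <|
    Real.sSup_le (fun _ hx => hx.1.2) (D.lo_nonneg.trans D.lo_lt_hi.le)⟩

lemma lt_of_inferredType_lt (hx : x ∈ Set.Icc D.lo D.hi) (h : D.inferredType β p < x) :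
    p < β x := by
  by_contra! hle
  have hle_sSup : x ≤ sSup {z : ℝ | z ∈ Set.Icc D.lo D.hi ∧ β z ≤ p} :=
    le_csSup ⟨D.hi, fun z hz => hz.1.2⟩ ⟨hx, hle⟩
  exact h.not_ge (hle_sSup.trans (le_max_right _ _))

variable (hβ : StrictMonoOn β (Set.Icc D.lo D.hi))
include hβ

lemma lt_of_lt_inferredType (hx : x ∈ Set.Icc D.lo D.hi) (h : x < D.inferredType β p) :
    β x < p := by
  have hlt : x < sSup {z : ℝ | z ∈ Set.Icc D.lo D.hi ∧ β z ≤ p} :=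
    (lt_max_iff.mp h).resolve_left hx.1.not_gt
  have hne : {z : ℝ | z ∈ Set.Icc D.lo D.hi ∧ β z ≤ p}.Nonempty := by
    by_contra hempty
    rw [Set.not_nonempty_iff_eq_empty.mp hempty, Real.sSup_empty] at hlt
    exact hlt.not_ge (D.lo_nonneg.trans hx.1)
  obtain ⟨z, hz, hxz⟩ := exists_lt_of_lt_csSup hne hlt
  exact (hβ hx hz.1 hxz).trans_le hz.2

lemma inferredType_mono : Monotone (D.inferredType β) := by
  intro p p' hp
  by_contra! hlt
  obtain ⟨z, hz', hz⟩ := exists_between hlt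
  have hz_mem : z ∈ Set.Icc D.lo D.hi :=
    ⟨inferredType_mem_Icc.1.trans hz'.le, hz.le.trans inferredType_mem_Icc.2⟩
  exact (((lt_of_inferredType_lt hz_mem hz').trans (lt_of_lt_inferredType hβ hz_mem hz)).trans_le
    hp).false

lemma inferredType_apply (hx : x ∈ Set.Icc D.lo D.hi) : D.inferredType β (β x) = x := by
  rcases lt_trichotomy (D.inferredType β (β x)) x with h | h | h
  · exact (lt_of_inferredType_lt hx h).false.elim
  · exact h
  · exact (lt_of_lt_inferredType hβ hx h).false.elim

end InferredType

section Auction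

variable {σ : Equiv.Perm (Fin N)} {v r : Fin N → ℝ} {a b c i : Fin N}
  (hβ : StrictMonoOn β (Set.Icc D.lo D.hi)) (hv : D.inferredType β ∘ v = r)
  (hr : Function.Injective r)
include hβ hv hr

lemma isTopTwo_of_inferredType {s : Finset (Fin N)} (h : IsTopTwo s r a b) : IsTopTwo s v a b := by
  subst hv
  exact h.of_comp (inferredType_mono hβ) hr.injOn

lemma allocated_iff (hab : IsTopTwo Finset.univ r a b)
    (hbc : IsTopTwo (Finset.univ.erase a) r b c) :
    D.Allocated β v ↔ 0 ≤ D.virtualSurplus r := by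
  have hab' := isTopTwo_of_inferredType hβ hv hr hab
  have hbc' := isTopTwo_of_inferredType hβ hv hr hbc
  rw [Allocated, hab'.kthHighest_two, hab'.kthHighest_three hbc', D.virtualSurplus_eq hab hbc, ← hv]
  rfl

variable (hN : 3 ≤ N)
include hN

lemma isKthHighest_one_iff_topRival_lt :
    IsKthHighest σ Finset.univ v 1 i ↔ topRival i r < r i := by
  obtain ⟨a, b, c, hab, -⟩ := exists_isTopTwo_isTopTwo_erase_univ hN hr
  rw [(isTopTwo_of_inferredType hβ hv hr hab).isKthHighest_one_iff, topRival_lt_iff hab]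

lemma getsFirst_iff_winsAsSecond : D.GetsFirst σ β v i ↔ D.WinsAsSecond i (r i) r := by
  obtain ⟨a, b, c, hab, hbc⟩ := exists_isTopTwo_isTopTwo_erase_univ hN hr
  rw [GetsFirst, allocated_iff hβ hv hr hab hbc, winsAsSecond_iff hab hbc,
    (isTopTwo_of_inferredType hβ hv hr hab).isKthHighest_two_iff
      (isTopTwo_of_inferredType hβ hv hr hbc)]

open scoped Classical in
lemma remaining_eq (hab : IsTopTwo Finset.univ r a b)
    (hbc : IsTopTwo (Finset.univ.erase a) r b c) :
    D.remaining σ β v =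
      if 0 ≤ D.virtualSurplus r then Finset.univ.erase b else Finset.univ := by
  ext j
  simp only [remaining, Finset.mem_filter, getsFirst_iff_winsAsSecond hβ hv hr hN,
    winsAsSecond_iff hab hbc]
  split_ifs with hvs <;> simp [hvs]

lemma two_le_card_remaining : 2 ≤ (D.remaining σ β v).card := by
  classical
  obtain ⟨a, b, c, hab, hbc⟩ := exists_isTopTwo_isTopTwo_erase_univ hN hr
  rw [remaining_eq hβ hv hr hN hab hbc]
  split_ifs
  · exact two_le_card_univ_erase hN b
  · rw [Finset.card_univ, Fintype.card_fin]; omega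

open scoped Classical in
lemma kthHighest_remaining_erase :
    kthHighest ((D.remaining σ β v).erase i) r 1 =
      if topRival i r < r i then D.rivalPrice i r else topRival i r := by
  obtain ⟨a, b, c, hab, hbc⟩ := exists_isTopTwo_isTopTwo_erase_univ hN hr
  have hac := hab.erase_right hbc
  rw [remaining_eq hβ hv hr hN hab hbc]
  simp only [topRival_lt_iff hab]
  rcases eq_or_ne i a with rfl | hia
  · rw [if_pos rfl, rivalPrice_left hab hbc]
    split_ifs
    · exact hac.kthHighest_erase_left_one
    · exact hab.kthHighest_erase_left_one
  · rw [if_neg hia, topRival, hab.kthHighest_erase_one_of_ne hia]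
    split_ifs
    · exact hac.kthHighest_erase_one_of_ne hia
    · exact hab.kthHighest_erase_one_of_ne hia

open scoped Classical in
lemma netPayment_eq {z : ℝ} (hz : Function.Injective (Function.update r i z)) :
    D.netPayment σ β v (Function.update r i z) i =
      if topRival i r < r i then v i - (if D.rivalPrice i r < z then D.rivalPrice i r else 0)
      else if D.WinsAsSecond i (r i) r then v i else 0 := by
  have hfirst := getsFirst_iff_winsAsSecond (σ := σ) (i := i) hβ hv hr hN
  rw [netPayment, secondPrice]
  simp only [isKthHighest_one_iff_topRival_lt hβ hv hr hN, hfirst]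
  by_cases htop : topRival i r < r i
  · have hsecond : ¬ D.WinsAsSecond i (r i) r := fun h => htop.not_gt h.1
    have hmem : i ∈ D.remaining σ β v := by simpa [remaining, hfirst] using hsecond
    simp only [htop, true_or, true_and, if_true]
    rw [ite_isKthHighest_one_kthHighest_two (two_le_card_remaining hβ hv hr hN) hz hmem,
      kthHighest_erase_update, kthHighest_remaining_erase hβ hv hr hN, if_pos htop,
      Function.update_self]
  · simp only [htop, false_or, false_and, if_false, sub_zero]

open scoped Classical in
lemma auctionPayoff_eq {z : ℝ} (hz : Function.Injective (Function.update r i z)) :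
    D.auctionPayoff σ β v (Function.update r i z) i =
      if topRival i r < r i then (if D.rivalPrice i r < z then z else 0) - v i
      else if D.WinsAsSecond i (r i) r then z - v i else max (z - topRival i r) 0 := by
  rw [auctionPayoff, netPayment_eq hβ hv hr hN hz, secondAuctionSurplus_update]
  simp only [getsFirst_iff_winsAsSecond hβ hv hr hN, Function.update_self]
  by_cases hsecond : D.WinsAsSecond i (r i) r
  · simp only [hsecond, hsecond.1.not_gt, if_true, if_false]
  simp only [hsecond, if_false, kthHighest_remaining_erase hβ hv hr hN]
  split_ifs with htop hprice
  · rw [max_eq_left (by linarith)]; ring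
  · rw [max_eq_right (by linarith)]; ring
  · rw [sub_zero]

end Auction

end ValueDistribution

namespace ValueDistribution

section DeviationPayoff

variable {D : ValueDistribution} {N : ℕ} {β : ℝ → ℝ} {i : Fin N} {p z : ℝ} {y : Fin N → ℝ}
  (hβ : StrictMonoOn β (Set.Icc D.lo D.hi))
include hβ

lemma inferredType_comp_update (hy : ∀ j, y j ∈ Set.Icc D.lo D.hi) (i : Fin N) (p : ℝ) :
    D.inferredType β ∘ Function.update (fun j => β (y j)) i p =
      Function.update y i (D.inferredType β p) := by
  rw [Function.comp_update]
  congr 1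
  exact funext fun j => inferredType_apply hβ (hy j)

variable (hN : 3 ≤ N) (σ : Equiv.Perm (Fin N))
include hN

open scoped Classical in
lemma deviationPayoff_eq (hy : ∀ j, y j ∈ Set.Icc D.lo D.hi)
    (hq : Function.Injective (Function.update y i (D.inferredType β p)))
    (hz : Function.Injective (Function.update y i z)) :
    D.deviationPayoff σ β i z p y =
      if topRival i y < D.inferredType β p then (if D.rivalPrice i y < z then z else 0) - p
      else if D.WinsAsSecond i (D.inferredType β p) y then z - p
      else max (z - topRival i y) 0 := by
  have hpayoff := auctionPayoff_eq (σ := σ) (i := i) (z := z) hβ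
    (inferredType_comp_update hβ hy i p) hq hN (by rwa [Function.update_idem])
  simpa only [deviationPayoff, Function.update_idem, Function.update_self, topRival_update,
    rivalPrice_update, winsAsSecond_update] using hpayoff

open scoped Classical in
lemma deviationPayoff_ae_eq (i : Fin N) (z p : ℝ) :
    D.deviationPayoff σ β i z p =ᵐ[D.jointLaw N] fun y =>
      if topRival i y < D.inferredType β p then (if D.rivalPrice i y < z then z else 0) - p
      else if D.WinsAsSecond i (D.inferredType β p) y then z - p
      else max (z - topRival i y) 0 := by
  filter_upwards [D.ae_forall_mem_Icc, ae_injective_update i (D.inferredType β p),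
    ae_injective_update i z] with y hy hq hz using deviationPayoff_eq hβ hN σ hy hq hz

lemma integrable_deviationPayoff (i : Fin N) (hz : z ∈ Set.Icc D.lo D.hi) (p : ℝ) :
    Integrable (D.deviationPayoff σ β i z p) (D.jointLaw N) := by
  classical
  have htop := measurable_topRival hN i
  have hformula := deviationPayoff_ae_eq hβ hN σ i z p
  refine Integrable.of_mem_Icc (-|p|) (D.hi + |p|) (AEMeasurable.congr ?_ hformula.symm) ?_
  · exact (Measurable.ite (measurableSet_lt htop measurable_const)
      ((Measurable.ite (measurableSet_lt (measurable_rivalPrice hN i) measurable_const)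
        measurable_const measurable_const).sub measurable_const)
      (Measurable.ite (measurableSet_winsAsSecond hN i measurable_const) measurable_const
        ((measurable_const.sub htop).max measurable_const))).aemeasurable
  filter_upwards [hformula, D.ae_forall_mem_Icc] with y hy hmem
  have htop_nonneg : 0 ≤ topRival i y :=
    D.lo_nonneg.trans (topRival_mem (A := Set.Ici D.lo) hN fun j _ => (hmem j).1)
  have hz_nonneg := D.lo_nonneg.trans hz.1
  rw [hy]
  constructor <;> grind

end DeviationPayoff

section Equilibrium

variable {D : ValueDistribution} {N : ℕ} {z : ℝ} (hN : 3 ≤ N)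
  (hψ : MonotoneOn D.psi (Set.Ioo D.lo D.hi))
  (hdiff : DifferentiableOn ℝ D.psi (Set.Ioo (D.a 0) D.psiInvZero)) (σ : Equiv.Perm (Fin N))

include hN hψ hdiff in
lemma bid_inferredType_le {p : ℝ} (h : D.lo < D.inferredType (D.bid N) p) :
    D.bid N (D.inferredType (D.bid N) p) ≤ p :=
  D.bid_le_of_forall_lt hN hψ hdiff ⟨h, inferredType_mem_Icc.2⟩ fun _ hx =>
    (lt_of_lt_inferredType (D.bid_strictMonoOn hN hψ hdiff)
      ⟨hx.1.le, hx.2.le.trans inferredType_mem_Icc.2⟩ hx.2).le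

lemma integral_deviationPayoff_bid_self (i : Fin N) (hz : z ∈ Set.Icc D.lo D.hi) :
    ∫ y, D.deviationPayoff σ (D.bid N) i z (D.bid N z) y ∂D.jointLaw N =
      (optimalMechanism hN hψ hdiff).interimPayoff i z z := by
  classical
  have hβ := D.bid_strictMonoOn hN hψ hdiff
  refine integral_congr_ae ?_
  filter_upwards [deviationPayoff_ae_eq hβ hN σ i z (D.bid N z), ae_injective_update i z]
    with y hy hinj
  rw [hy, inferredType_apply hβ hz, payoff_optimalMechanism hN hψ hdiff hinj hz]
  split_ifs with htop hprice
  · rw [max_eq_left hprice.le]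
  · exact (hprice ((rivalPrice_le_topRival hN).trans_lt htop)).elim
  · rfl
  · rfl

lemma integral_deviationPayoff_bid_le (i : Fin N) (hz : z ∈ Set.Icc D.lo D.hi) (p : ℝ) :
    ∫ y, D.deviationPayoff σ (D.bid N) i z p y ∂D.jointLaw N ≤
      (optimalMechanism hN hψ hdiff).interimPayoff i (D.inferredType (D.bid N) p) z := by
  classical
  set M := optimalMechanism hN hψ hdiff
  have hβ := D.bid_strictMonoOn hN hψ hdiff
  have hq : D.inferredType (D.bid N) p ∈ Set.Icc D.lo D.hi := inferredType_mem_Icc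
  refine integral_mono_ae (integrable_deviationPayoff hβ hN σ i hz p)
    ((M.integrable_gross_update hN i hq hz).sub (M.integrable_t_update i _ hq)) ?_
  filter_upwards [deviationPayoff_ae_eq hβ hN σ i z p,
    ae_injective_update i (D.inferredType (D.bid N) p), D.ae_forall_mem_Ioo,
    ae_lo_lt_secondRival hN i] with y hy hinj hmem hlo
  have htop_lo : D.lo < topRival i y :=
    topRival_mem (A := Set.Ioi D.lo) hN fun j _ => (hmem j).1
  have hz_nonneg := D.lo_nonneg.trans hz.1
  rw [hy, payoff_optimalMechanism hN hψ hdiff hinj hq]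
  split_ifs with htop hprice hsecond
  · exact sub_le_sub (le_max_left _ _) (bid_inferredType_le hN hψ hdiff (htop_lo.trans htop))
  · exact sub_le_sub (hz_nonneg.trans (le_max_left _ _))
      (bid_inferredType_le hN hψ hdiff (htop_lo.trans htop))
  · exact sub_le_sub_left (bid_inferredType_le hN hψ hdiff (hlo.trans hsecond.2.1)) z
  · rfl

include hN hψ hdiff

lemma isSymmetricEquilibrium_bid : D.IsSymmetricEquilibrium σ (D.bid N) := by
  intro i z hz
  rw [integral_deviationPayoff_bid_self hN hψ hdiff σ i hz]
  exact ⟨integrable_deviationPayoff (D.bid_strictMonoOn hN hψ hdiff) hN σ i hz,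
    fun p => (integral_deviationPayoff_bid_le hN hψ hdiff σ i hz p).trans
      (incentiveCompatible_optimalMechanism hN hψ hdiff i z hz _ inferredType_mem_Icc),
    individuallyRational_optimalMechanism hN hψ hdiff i z hz⟩

lemma auctionRevenue_ae_eq : D.auctionRevenue σ (D.bid N) =ᵐ[D.jointLaw N]
    fun x => ∑ i, (optimalMechanism hN hψ hdiff).t x i := by
  classical
  have hβ := D.bid_strictMonoOn hN hψ hdiff
  filter_upwards [D.ae_injective, D.ae_forall_mem_Icc] with x hinj hmem
  refine Finset.sum_congr rfl fun i _ => ?_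
  have htypes : D.inferredType (D.bid N) ∘ (fun j => D.bid N (x j)) = x :=
    funext fun j => inferredType_apply hβ (hmem j)
  have hpay := netPayment_eq (σ := σ) (i := i) (z := x i) hβ htypes hinj hN
    (by rwa [Function.update_eq_self])
  rw [Function.update_eq_self] at hpay
  change _ = D.optimalPayment x i
  rw [hpay, optimalPayment, extendedBid_eq (hmem i)]
  split_ifs with htop hprice
  · rfl
  · exact (hprice ((rivalPrice_le_topRival hN).trans_lt htop)).elim
  · rfl
  · rfl

end Equilibrium

end ValueDistribution

theorem theorem6 (D : ValueDistribution) (N : ℕ) (hN : 3 ≤ N)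
    (hψ : MonotoneOn D.psi (Set.Ioo D.lo D.hi))
    (hdiff : DifferentiableOn ℝ D.psi (Set.Ioo (D.a 0) D.psiInvZero))
    (σ : Equiv.Perm (Fin N)) :
    StrictMonoOn (D.bid N) (Set.Icc D.lo D.hi) ∧
    D.IsSymmetricEquilibrium σ (D.bid N) ∧
    Integrable (D.auctionRevenue σ (D.bid N)) (D.jointLaw N) ∧
    IsGreatest
      {R : ℝ | ∃ M : D.DirectMechanism N,
        M.IncentiveCompatible ∧ M.IndividuallyRational ∧ M.revenue = R}
      (∫ x, D.auctionRevenue σ (D.bid N) x ∂(D.jointLaw N)) ∧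
    ∫ x, D.auctionRevenue σ (D.bid N) x ∂(D.jointLaw N) =
      ∫ x, max (D.psi (kthHighest Finset.univ x 2) + kthHighest Finset.univ x 2
        - kthHighest Finset.univ x 3) 0 ∂(D.jointLaw N) := by
  let M := ValueDistribution.optimalMechanism hN hψ hdiff
  have hIC : M.IncentiveCompatible :=
    ValueDistribution.incentiveCompatible_optimalMechanism hN hψ hdiff
  have hIR : M.IndividuallyRational :=
    ValueDistribution.individuallyRational_optimalMechanism hN hψ hdiff
  have hopt : M.revenue = ∫ x, max (D.virtualSurplus x) 0 ∂D.jointLaw N :=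
    ValueDistribution.revenue_optimalMechanism hN hψ hdiff
  have hae := ValueDistribution.auctionRevenue_ae_eq hN hψ hdiff σ
  have hrev : ∫ x, D.auctionRevenue σ (D.bid N) x ∂D.jointLaw N = M.revenue :=
    integral_congr_ae hae
  refine ⟨D.bid_strictMonoOn hN hψ hdiff,
    ValueDistribution.isSymmetricEquilibrium_bid hN hψ hdiff σ,
    (integrable_finsetSum _ fun i _ => M.integrable_t i).congr hae.symm,
    ⟨⟨M, hIC, hIR, hrev.symm⟩, ?_⟩, hrev.trans hopt⟩
  rintro _ ⟨M', hIC', hIR', rfl⟩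
  exact (hIC'.revenue_le hIR' hN hψ).trans_eq (hrev.trans hopt).symm
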